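/- A \emph{planar tree} is a locally finite rooted tree, considered up to isomorphism, in which the offspring of each vertex are linearly ordered and whose root has exactly one child. Let $\mathcal T$ be the set of all (finite or infinite) planar trees. For $T\in\mathcal T$ let $|T|\in\{1,2,\dots\}\cup\{\infty\}$ be its number of edges, let $D_r(T)$ be the set of vertices at graph distance $r$ from the root, and let $B_r(T)$ be the subtree spanned by the vertices at distance at most $r$ from the root; the height $h(T)$ is the maximal distance of a vertex from the root. Equip $\mathcal T$ with the metric $$\mathrm{dist}(T,T')=\inf\Big\{\tfrac1r \;\Big|\; r\in\{1,2,\dots\},\ B_r(T)=B_r(T')\Big\}$$ and its Borel $\sigma$-algebra, and write $\mathcal B_a(T_0)=\{T\in\mathcal T\mid \mathrm{dist}(T,T_0)\le a\}$. For $\mu\in\mathbb R$ and $N\ge 1$ let $\nu_N^{(\mu)}$ be the probability measure on $\mathcal T$ supported on the finite set $\mathcal T_N=\{T\in\mathcal T\mid |T|=N\}$ with $$\nu_N^{(\mu)}(\{T\})=\frac{e^{-\mu h(T)}}{Z_N^{(\mu)}}\quad (T\in\mathcal T_N),\qquad Z_N^{(\mu)}=\sum_{T\in\mathcal T_N}e^{-\mu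 h(T)}.$$ \textbf{Theorem.} For every $\mu>0$ the sequence $(\nu_N^{(\mu)})_{N\ge1}$ converges weakly, as $N\to\infty$, to a Borel probability measure $\nu^{(\mu)}$ on $\mathcal T$. This measure satisfies $$\nu^{(\mu)}\big(\mathcal B_{1/r}(T_0)\big)=\frac{e^{-\mu(r-1)}}{4^{|T_0|}}\,2^{K+1}\sum_{R=1}^{K}\binom KR\frac{\mu^{R-1}}{(R-1)!},\qquad K=|D_r(T_0)|,$$ for every finite tree $T_0\in\mathcal T$ of height $r\ge1$, and it is the only Borel probability measure on $\mathcal T$ with this property. -/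

import Mathlib

open MeasureTheory Filter Topology

/-- A locally finite rooted planar tree, in the usual (Ulam–Harris–Neveu) encoding of isomorphism
classes: a vertex at distance `r` from the root is the word of length `r` whose letters say which
child (numbered `0, 1, 2, …` from left to right) is taken at each step.  So the root is `[]`, the
parent of `u ++ [n]` is `u`, and the vertices at distance `r` are ordered lexicographically.
The root has exactly one child, `[0]`. -/
@[ext]
structure PlanarTree where
  /-- the vertex set -/
  verts : Set (List ℕ)
  root_mem : [] ∈ verts
  singleton_mem_iff : ∀ n : ℕ, [n] ∈ verts ↔ n = 0
  parent_mem : ∀ (u : List ℕ) (n : ℕ), u ++ [n] ∈ verts → u ∈ verts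
  sibling_mem : ∀ (u : List ℕ) (m n : ℕ), m ≤ n → u ++ [n] ∈ verts → u ++ [m] ∈ verts
  locally_finite : ∀ u : List ℕ, {n : ℕ | u ++ [n] ∈ verts}.Finite

namespace PlanarTree

/-- `D_r(T)`: the vertices at distance `r` from the root. -/
def level (T : PlanarTree) (r : ℕ) : Set (List ℕ) := {u ∈ T.verts | u.length = r}

/-- The edges, as pairs (parent, child). -/
def edges (T : PlanarTree) : Set (List ℕ × List ℕ) :=
  {e | e.2 ∈ T.verts ∧ ∃ n : ℕ, e.2 = e.1 ++ [n]}

/-- The size `|T|`: the number of edges. -/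
noncomputable def size (T : PlanarTree) : ℕ∞ := T.edges.encard

/-- The tree has finitely many edges. -/
def IsFinite (T : PlanarTree) : Prop := T.edges.Finite

/-- The height `h(T)`: the maximal distance of a vertex from the root (`⊤` if unbounded). -/
noncomputable def height (T : PlanarTree) : ℕ∞ := ⨆ u ∈ T.verts, (u.length : ℕ∞)

/-- (The vertex set of) `B_r(T)`, the subtree spanned by the vertices at distance at most `r`
from the root. -/
def rootBall (T : PlanarTree) (r : ℕ) : Set (List ℕ) := {u ∈ T.verts | u.length ≤ r}

/-- `dist(T, T') = inf {1/r | r ≥ 1, B_r(T) = B_r(T')}`. -/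
noncomputable instance : Dist PlanarTree where
  dist T T' := sInf {x : ℝ | ∃ r : ℕ, 1 ≤ r ∧ T.rootBall r = T'.rootBall r ∧ x = 1 / (r : ℝ)}

theorem dist_def (T T' : PlanarTree) : dist T T' =
    sInf {x : ℝ | ∃ r : ℕ, 1 ≤ r ∧ T.rootBall r = T'.rootBall r ∧ x = 1 / (r : ℝ)} := rfl

theorem rootBall_one_eq (T T' : PlanarTree) : T.rootBall 1 = T'.rootBall 1 := by
  ext u
  match u with
  | [] => simp [rootBall, T.root_mem, T'.root_mem]
  | [n] => simp [rootBall, T.singleton_mem_iff, T'.singleton_mem_iff]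
  | a :: b :: l => simp [rootBall]

theorem rootBall_eq_of_le {T T' : PlanarTree} {r s : ℕ} (h : r ≤ s)
    (e : T.rootBall s = T'.rootBall s) : T.rootBall r = T'.rootBall r := by
  ext u
  have := Set.ext_iff.1 e u
  simp only [rootBall, Set.mem_ofPred_eq] at this ⊢
  constructor <;> rintro ⟨h1, h2⟩
  · exact ⟨(this.1 ⟨h1, h2.trans h⟩).1, h2⟩
  · exact ⟨(this.2 ⟨h1, h2.trans h⟩).1, h2⟩

theorem dist_set_nonempty (T T' : PlanarTree) :
    {x : ℝ | ∃ r : ℕ, 1 ≤ r ∧ T.rootBall r = T'.rootBall r ∧ x = 1 / (r : ℝ)}.Nonempty :=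
  ⟨_, 1, le_rfl, rootBall_one_eq T T', rfl⟩

theorem dist_le_of_rootBall_eq {T T' : PlanarTree} {r : ℕ} (hr : 1 ≤ r)
    (e : T.rootBall r = T'.rootBall r) : dist T T' ≤ 1 / (r : ℝ) := by
  refine csInf_le ⟨0, ?_⟩ ⟨r, hr, e, rfl⟩
  rintro x ⟨s, -, -, rfl⟩
  positivity

theorem le_dist {T T' : PlanarTree} {a : ℝ}
    (h : ∀ r : ℕ, 1 ≤ r → T.rootBall r = T'.rootBall r → a ≤ 1 / (r : ℝ)) : a ≤ dist T T' := by
  refine le_csInf (dist_set_nonempty T T') ?_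
  rintro x ⟨r, hr, e, rfl⟩
  exact h r hr e

noncomputable instance : MetricSpace PlanarTree where
  dist_self T := by
    refine le_antisymm ?_ (le_dist fun r _ _ => by positivity)
    refine le_of_forall_pos_le_add fun ε hε => ?_
    obtain ⟨n, hn⟩ := exists_nat_one_div_lt hε
    have := dist_le_of_rootBall_eq (T := T) (T' := T) (r := n + 1) (by omega) rfl
    push_cast at this
    linarith
  dist_comm T T' := by
    simp only [dist_def, eq_comm]
  dist_triangle T T' T'' := by
    have key : ∀ r : ℕ, 1 ≤ r → T.rootBall r = T'.rootBall r → ∀ s : ℕ, 1 ≤ s →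
        T'.rootBall s = T''.rootBall s → dist T T'' ≤ 1 / (r : ℝ) + 1 / (s : ℝ) := by
      intro r hr e s hs e'
      rcases le_total r s with h | h
      · refine (dist_le_of_rootBall_eq hr (e.trans (rootBall_eq_of_le h e'))).trans ?_
        have : (0 : ℝ) ≤ 1 / (s : ℝ) := by positivity
        linarith
      · refine (dist_le_of_rootBall_eq hs ((rootBall_eq_of_le h e).trans e')).trans ?_
        have : (0 : ℝ) ≤ 1 / (r : ℝ) := by positivity
        linarith
    rw [← sub_le_iff_le_add]
    refine le_dist fun r hr e => ?_
    rw [sub_le_comm]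
    refine le_dist fun s hs e' => ?_
    linarith [key r hr e s hs e']
  eq_of_dist_eq_zero := by
    intro T T' h
    by_contra hne
    have hv : ¬ ∀ u, u ∈ T.verts ↔ u ∈ T'.verts := fun h' => hne (PlanarTree.ext (Set.ext h'))
    obtain ⟨u, hu⟩ := not_forall.1 hv
    have : 1 / ((u.length : ℝ) + 1) ≤ dist T T' := by
      refine le_dist fun r hr e => ?_
      have hlt : r < u.length := by
        by_contra hle
        have := Set.ext_iff.1 e u
        simp only [rootBall, Set.mem_ofPred_eq, not_lt.1 hle, and_true] at this
        exact hu this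
      apply one_div_le_one_div_of_le
      · exact_mod_cast hr
      · exact_mod_cast (by omega : r ≤ u.length + 1)
    have h0 : (0 : ℝ) < 1 / ((u.length : ℝ) + 1) := by positivity
    linarith

noncomputable instance : MeasurableSpace PlanarTree := borel PlanarTree

instance : BorelSpace PlanarTree := ⟨rfl⟩

/-- `𝒯_N`: the trees of size `N`. -/
def treesOfSize (N : ℕ) : Set PlanarTree := {T | T.size = N}

theorem mem_of_append (T : PlanarTree) (u v : List ℕ) (h : u ++ v ∈ T.verts) : u ∈ T.verts := by
  induction v using List.reverseRecOn with
  | nil => simpa using h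
  | append_singleton v n ih => exact ih (T.parent_mem _ n (by simpa using h))

/-- A tree with `N` edges has at most `N` siblings in each family and height at most `N`. -/
theorem bound_of_size {T : PlanarTree} {N : ℕ} (h : T.size = N) (u : List ℕ) (hu : u ∈ T.verts) :
    u.length ≤ N ∧ ∀ n ∈ u, n < N := by
  have card_le : ∀ (k : ℕ) (f : ℕ → List ℕ × List ℕ), Function.Injective f →
      (∀ i < k, f i ∈ T.edges) → k ≤ N := by
    intro k f hf hk
    have h1 : (f '' (Set.Iio k)).encard ≤ T.edges.encard := by
      apply Set.encard_le_encard
      rintro _ ⟨i, hi, rfl⟩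
      exact hk i hi
    rw [hf.encard_image] at h1
    have h2 : T.edges.encard = N := h
    rw [h2, ← Finset.coe_Iio, Set.encard_coe_eq_coe_finsetCard] at h1
    simpa using h1
  constructor
  · by_contra hlt
    have hmem : ∀ i < u.length, (u.take i, u.take (i + 1)) ∈ T.edges := by
      intro i hi
      refine ⟨T.mem_of_append _ (u.drop (i + 1)) (by simpa using hu), u[i], ?_⟩
      simp
    have h1 : ((fun i => (u.take i, u.take (i + 1))) '' (Set.Iio u.length)).encard
        ≤ T.edges.encard := by
      apply Set.encard_le_encard
      rintro _ ⟨i, hi, rfl⟩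
      exact hmem i hi
    have hinj : Set.InjOn (fun i => (u.take i, u.take (i + 1))) (Set.Iio u.length) := by
      intro i hi j hj hij
      have := congrArg (fun e : List ℕ × List ℕ => e.1.length) hij
      simp only [List.length_take, Set.mem_Iio] at this hi hj
      omega
    have h2 : T.edges.encard = N := h
    rw [hinj.encard_image, h2, ← Finset.coe_Iio, Set.encard_coe_eq_coe_finsetCard] at h1
    simp only [Nat.card_Iio, Nat.cast_le] at h1
    exact hlt h1
  · intro n hn
    obtain ⟨p, q, rfl⟩ := List.append_of_mem hn
    have hp : p ++ [n] ∈ T.verts := T.mem_of_append _ q (by simpa using hu)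
    refine card_le (n + 1) (fun i => (p, p ++ [i])) ?_ ?_
    · intro i j hij
      simpa using hij
    · intro i hi
      exact ⟨T.sibling_mem p i n (by omega) hp, i, rfl⟩

theorem treesOfSize_finite (N : ℕ) : (treesOfSize N).Finite := by
  have hfin : {u : List ℕ | u.length ≤ N ∧ ∀ n ∈ u, n < N}.Finite := by
    refine ((List.finite_length_le (Fin N) N).image (List.map Fin.val)).subset ?_
    rintro u ⟨h1, h2⟩
    refine ⟨u.pmap (fun n hn => ⟨n, hn⟩) h2, by simpa using h1, ?_⟩
    simp [List.map_pmap]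
  refine Set.Finite.of_finite_image (f := verts) (hfin.finite_subsets.subset ?_) ?_
  · rintro _ ⟨T, hT, rfl⟩ u hu
    exact bound_of_size hT u hu
  · intro T _ T' _ h
    exact PlanarTree.ext h

/-- The linear tree with `N ≥ 1` edges. -/
def path (N : ℕ) (hN : 1 ≤ N) : PlanarTree where
  verts := {u | u.length ≤ N ∧ ∀ n ∈ u, n = 0}
  root_mem := by simp
  singleton_mem_iff n := by simp [hN]
  parent_mem u n h := by
    simp only [Set.mem_ofPred_eq, List.length_append, List.length_singleton, List.mem_append] at h ⊢
    exact ⟨by omega, fun m hm => h.2 m (Or.inl hm)⟩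
  sibling_mem u m n hmn h := by
    have h0 : n = 0 := h.2 n (by simp)
    have : m = n := by omega
    rwa [this]
  locally_finite u := by
    refine (Set.finite_singleton 0).subset fun n h => ?_
    exact h.2 n (by simp)

theorem path_mem (N : ℕ) (hN : 1 ≤ N) : path N hN ∈ treesOfSize N := by
  have : (path N hN).edges =
      (fun i => (List.replicate i 0, List.replicate (i + 1) 0)) '' (Set.Iio N) := by
    ext ⟨u, v⟩
    simp only [edges, path, Set.mem_ofPred_eq, Set.mem_image, Set.mem_Iio, Prod.mk.injEq]
    constructor
    · rintro ⟨⟨h1, h2⟩, n, rfl⟩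
      have hu : u = List.replicate u.length 0 :=
        List.eq_replicate_iff.2 ⟨rfl, fun m hm => h2 m (by simp [hm])⟩
      have hn : n = 0 := h2 n (by simp)
      refine ⟨u.length, by simpa using h1, hu.symm, ?_⟩
      rw [List.replicate_succ', ← hu, hn]
    · rintro ⟨i, hi, rfl, rfl⟩
      refine ⟨⟨by simpa using hi, fun n hn => (List.mem_replicate.1 hn).2⟩, 0, ?_⟩
      rw [List.replicate_succ']
  have hinj : Function.Injective
      (fun i => (List.replicate i 0, List.replicate (i + 1) 0) : ℕ → List ℕ × List ℕ) := by
    intro i j hij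
    simpa using congrArg (fun e : List ℕ × List ℕ => e.1.length) hij
  rw [treesOfSize, Set.mem_ofPred_eq, size, this, hinj.encard_image, ← Finset.coe_Iio,
    Set.encard_coe_eq_coe_finsetCard]
  simp

/-- `𝒯_N` as a finite set. -/
noncomputable def treeFinset (N : ℕ) : Finset PlanarTree := (treesOfSize_finite N).toFinset

/-- The weight `e^{-μ h(T)}` of a finite tree. -/
noncomputable def weight (μ : ℝ) (T : PlanarTree) : ℝ := Real.exp (-μ * (T.height.toNat : ℝ))

/-- The partition function `Z_N^{(μ)}`, the total weight of the trees of size `N`. -/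
noncomputable def partitionFunction (μ : ℝ) (N : ℕ) : ℝ := ∑ T ∈ treeFinset N, weight μ T

theorem partitionFunction_pos (μ : ℝ) {N : ℕ} (hN : 1 ≤ N) : 0 < partitionFunction μ N :=
  Finset.sum_pos (fun _ _ => Real.exp_pos _)
    ⟨path N hN, (treesOfSize_finite N).mem_toFinset.2 (path_mem N hN)⟩

/-- The measure on trees with mass `e^{-μ h(T)} / Z_N^{(μ)}` at each tree `T` of size `N`. -/
noncomputable def gibbsMeasure (μ : ℝ) (N : ℕ) : Measure PlanarTree :=
  ∑ T ∈ treeFinset N, ENNReal.ofReal (weight μ T / partitionFunction μ N) • Measure.dirac T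

theorem isProbabilityMeasure_gibbsMeasure (μ : ℝ) {N : ℕ} (hN : 1 ≤ N) :
    IsProbabilityMeasure (gibbsMeasure μ N) := by
  have hZ := partitionFunction_pos μ hN
  constructor
  simp only [gibbsMeasure, Measure.coe_finsetSum, Finset.sum_apply, Measure.smul_apply,
    measure_univ, smul_eq_mul, mul_one]
  rw [← ENNReal.ofReal_sum_of_nonneg, ← Finset.sum_div]
  · change ENNReal.ofReal (partitionFunction μ N / partitionFunction μ N) = 1
    rw [div_self hZ.ne', ENNReal.ofReal_one]
  · intro T _
    exact div_nonneg (Real.exp_pos _).le hZ.le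

/-- `ν_N^{(μ)}`, for `N ≥ 1`, as a Borel probability measure on the space of all trees. -/
noncomputable def nu (μ : ℝ) (N : ℕ+) : ProbabilityMeasure PlanarTree :=
  ⟨gibbsMeasure μ N, isProbabilityMeasure_gibbsMeasure μ N.pos⟩

/-- `ν` takes the values
`ν(ℬ_{1/r}(T₀)) = e^{-μ(r-1)} 4^{-|T₀|} 2^{K+1} ∑_{R=1}^K C(K,R) μ^{R-1}/(R-1)!`, `K = |D_r(T₀)|`,
on the closed balls of radius `1/r` around the finite trees `T₀` of height `r ≥ 1`. -/
def HasBallVolumes (μ : ℝ) (ν : ProbabilityMeasure PlanarTree) : Prop :=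
  ∀ (r : ℕ) (T₀ : PlanarTree), 1 ≤ r → T₀.IsFinite → T₀.height = r →
    (ν : Measure PlanarTree).real (Metric.closedBall T₀ (1 / (r : ℝ))) =
      Real.exp (-μ * ((r : ℝ) - 1)) / 4 ^ T₀.size.toNat * 2 ^ ((T₀.level r).ncard + 1) *
        ∑ R ∈ Finset.Icc 1 (T₀.level r).ncard,
          ((T₀.level r).ncard.choose R : ℝ) * (μ ^ (R - 1) / ((R - 1).factorial : ℝ))

end PlanarTree

/-!
Put `q = exp (-μ)` and let `W K n` be the total weight `∑ q ^ h` of the planar forests with `K`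
roots and `n` edges. Cutting the trees of size `N` at distance `r` from the root gives a tree `T` of
height `r` with `K` vertices on its last level the mass
`q ^ (r - 1) * W K (N - |T|) / W 1 (N - 1)`, so that everything rests on the asymptotics of `W`.

* The sums `∑ κ ^ K * W (K + 1) n` are mixtures over `m` of the coefficients of
  `(1 - (1 - κ)⁻¹ X F_m)⁻¹`, where `F_m = (1 - X F_{m - 1})⁻¹` is the generating function of the
  trees of height less than `m`. Renewal equations preserve log-convexity (Kaluza), so the ratios
  of consecutive sums increase. Their limit is `4`, because no growth rate below `4` is possible
  for all `F_m` at once.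
* Hence `W (K + 1) n / W 1 n` varies slowly with `n`, and each of its limit points is a nonnegative
  eigenvector of the transfer operator from one level to the next.
* In the coordinate `κ = y / (2 * (1 + y))` the generating function `P` of an eigenvector satisfies
  `P (y + 1) = ((2 + y) / (1 + y)) ^ 2 * exp μ * P y`, while Hölder's inequality makes `P`
  log-convex in `1 / y`. As in the Bohr–Mollerup theorem this forces
  `P y = (1 + y) ^ 2 * exp (μ * y)`, whose coefficients are the sums in the ball volumes.
* The eigenvector equation says that the limiting masses of the balls around the trees of height
  `r` add up to `1`. Therefore no mass escapes, and these masses determine the limit.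
-/

namespace PlanarTree

section Vertices

variable {S T T' : PlanarTree} {r : ℕ} {u : List ℕ}

theorem mem_rootBall : u ∈ T.rootBall r ↔ u ∈ T.verts ∧ u.length ≤ r := Iff.rfl

theorem mem_level : u ∈ T.level r ↔ u ∈ T.verts ∧ u.length = r := Iff.rfl

theorem verts_subset_of_rootBall_eq (h : T'.rootBall r = T.verts) : T.verts ⊆ T'.verts :=
  fun _ hu ↦ (h.ge hu).1

theorem rootBall_finite (T : PlanarTree) (r : ℕ) : (T.rootBall r).Finite := by
  induction r with
  | zero =>
    refine (Set.finite_singleton []).subset fun u hu ↦ ?_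
    simpa using hu.2
  | succ r ih =>
    refine (ih.union (ih.biUnion fun u _ ↦ (T.locally_finite u).image fun n ↦ u ++ [n])).subset
      fun u hu ↦ ?_
    rcases List.eq_nil_or_concat' u with rfl | ⟨v, n, rfl⟩
    · exact Or.inl ⟨T.root_mem, by simp⟩
    · have hv : v.length ≤ r := by simpa using hu.2
      exact Or.inr (Set.mem_biUnion (⟨T.parent_mem v n hu.1, hv⟩ : v ∈ T.rootBall r)
        ⟨n, hu.1, rfl⟩)

theorem level_finite (T : PlanarTree) (r : ℕ) : (T.level r).Finite :=
  (T.rootBall_finite r).subset fun _ hu ↦ ⟨hu.1, hu.2.le⟩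

/-- `D_r(T)` as a finite set. -/
noncomputable def levelFinset (T : PlanarTree) (r : ℕ) : Finset (List ℕ) :=
  (T.level_finite r).toFinset

@[simp]
theorem mem_levelFinset : u ∈ T.levelFinset r ↔ u ∈ T.verts ∧ u.length = r := by
  rw [levelFinset, Set.Finite.mem_toFinset, mem_level]

theorem ncard_level (T : PlanarTree) (r : ℕ) : (T.level r).ncard = (T.levelFinset r).card :=
  Set.ncard_eq_toFinset_card _ (T.level_finite r)

theorem levelFinset_eq_of_rootBall_eq (h : S.rootBall r = T.rootBall r) :
    S.levelFinset r = T.levelFinset r := by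
  ext u
  have hu := Set.ext_iff.1 h u
  simp only [mem_rootBall, mem_levelFinset] at hu ⊢
  grind

/-- The number of children of a vertex. -/
noncomputable def childCount (T : PlanarTree) (u : List ℕ) : ℕ := {n : ℕ | u ++ [n] ∈ T.verts}.ncard

theorem append_singleton_mem_iff (T : PlanarTree) (u : List ℕ) (n : ℕ) :
    u ++ [n] ∈ T.verts ↔ n < T.childCount u := by
  constructor
  · intro hn
    have hsub : Set.Iic n ⊆ {m : ℕ | u ++ [m] ∈ T.verts} := fun m hm ↦ T.sibling_mem u m n hm hn
    have hle := Set.ncard_le_ncard hsub (T.locally_finite u)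
    rwa [← Finset.coe_Iic, Set.ncard_coe_finset, Nat.card_Iic, Nat.add_one_le_iff] at hle
  · contrapose!
    intro hn
    have hsub : {m : ℕ | u ++ [m] ∈ T.verts} ⊆ Set.Iio n := fun m hm ↦
      not_le.1 fun hnm ↦ hn (T.sibling_mem u n m hnm hm)
    have hle := Set.ncard_le_ncard hsub (Set.finite_Iio n)
    rwa [← Finset.coe_Iio, Set.ncard_coe_finset, Nat.card_Iio] at hle

theorem card_levelFinset_succ (T : PlanarTree) (r : ℕ) :
    (T.levelFinset (r + 1)).card = ∑ u ∈ T.levelFinset r, T.childCount u := by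
  have hlevel : T.levelFinset (r + 1) = ((T.levelFinset r).sigma fun u ↦
      Finset.range (T.childCount u)).image fun x ↦ x.1 ++ [x.2] := by
    ext v
    simp only [mem_levelFinset, Finset.mem_image, Finset.mem_sigma, Finset.mem_range,
      ← append_singleton_mem_iff, Sigma.exists]
    constructor
    · rintro ⟨hv, hlen⟩
      obtain ⟨u, n, rfl⟩ := (List.eq_nil_or_concat' v).resolve_left (by rintro rfl; simp at hlen)
      exact ⟨u, n, ⟨⟨T.parent_mem u n hv, by simpa using hlen⟩, hv⟩, rfl⟩
    · rintro ⟨u, n, ⟨⟨-, hlen⟩, hv⟩, rfl⟩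
      exact ⟨hv, by simp [hlen]⟩
  have hinj : Function.Injective fun x : Σ _ : List ℕ, ℕ ↦ x.1 ++ [x.2] := by
    rintro ⟨u, m⟩ ⟨v, n⟩ h
    obtain ⟨rfl, hmn⟩ := List.append_inj' h rfl
    simpa using hmn
  rw [hlevel, Finset.card_image_of_injective _ hinj, Finset.card_sigma]
  simp only [Finset.card_range]

end Vertices

section Height

variable {S T T' : PlanarTree} {r N : ℕ}

/-- The height of `T` is at most `r`, stated without suprema. -/
def HeightLE (T : PlanarTree) (r : ℕ) : Prop := ∀ u ∈ T.verts, u.length ≤ r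

theorem height_le_iff : T.height ≤ r ↔ T.HeightLE r := by
  simp only [height, HeightLE, iSup_le_iff, Nat.cast_le]

theorem heightLE_of_height_eq (h : T.height = r) : T.HeightLE r := height_le_iff.1 h.le

theorem heightLE_of_levelFinset_succ_eq_empty (h : T.levelFinset (r + 1) = ∅) : T.HeightLE r := by
  intro u hu
  by_contra! hlt
  have hmem : u.take (r + 1) ∈ T.levelFinset (r + 1) :=
    mem_levelFinset.2 ⟨T.mem_of_append _ (u.drop (r + 1)) (by simpa using hu), by simpa using hlt⟩
  simp [h] at hmem

theorem height_eq_iff (hr : 1 ≤ r) :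
    T.height = r ↔ T.HeightLE r ∧ (T.levelFinset r).Nonempty := by
  obtain ⟨r, rfl⟩ := Nat.exists_eq_add_of_le' hr
  constructor
  · refine fun h ↦ ⟨heightLE_of_height_eq h, ?_⟩
    by_contra! hempty
    have hle := height_le_iff.2 (heightLE_of_levelFinset_succ_eq_empty hempty)
    rw [h, Nat.cast_le] at hle
    omega
  · rintro ⟨hle, u, hu⟩
    rw [mem_levelFinset] at hu
    refine le_antisymm (height_le_iff.2 hle) ?_
    rw [← hu.2]
    exact le_iSup₂ (f := fun (u : List ℕ) (_ : u ∈ T.verts) ↦ (u.length : ℕ∞)) u hu.1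

theorem HeightLE.rootBall_eq (h : T.HeightLE r) : T.rootBall r = T.verts :=
  Set.ext fun u ↦ ⟨fun hu ↦ hu.1, fun hu ↦ ⟨hu, h u hu⟩⟩

theorem HeightLE.verts_finite (h : T.HeightLE r) : T.verts.Finite :=
  h.rootBall_eq ▸ T.rootBall_finite r

theorem HeightLE.eq_of_rootBall_eq (hS : S.HeightLE r) (h : S.rootBall r = T.verts) : S = T :=
  PlanarTree.ext (hS.rootBall_eq.symm.trans h)

theorem HeightLE.levelFinset_eq (hT : T.HeightLE r) (h : S.rootBall r = T.verts) :
    S.levelFinset r = T.levelFinset r :=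
  levelFinset_eq_of_rootBall_eq (h.trans hT.rootBall_eq.symm)

/-- The tree `B_r(T)`. -/
def trunc (T : PlanarTree) (r : ℕ) (hr : 1 ≤ r) : PlanarTree where
  verts := T.rootBall r
  root_mem := ⟨T.root_mem, by simp⟩
  singleton_mem_iff n := by simp [mem_rootBall, T.singleton_mem_iff, hr]
  parent_mem u n h := ⟨T.parent_mem u n h.1, le_trans (by simp) h.2⟩
  sibling_mem u m n hmn h := ⟨T.sibling_mem u m n hmn h.1, by simpa using h.2⟩
  locally_finite u := (T.locally_finite u).subset fun _ h ↦ h.1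

theorem trunc_heightLE (T : PlanarTree) (hr : 1 ≤ r) : (T.trunc r hr).HeightLE r :=
  fun _ hu ↦ hu.2

theorem rootBall_trunc (T : PlanarTree) {s : ℕ} (hs : 1 ≤ s) (h : r ≤ s) :
    (T.trunc s hs).rootBall r = T.rootBall r :=
  Set.ext fun _ ↦ ⟨fun hu ↦ ⟨hu.1.1, hu.2⟩, fun hu ↦ ⟨⟨hu.1, hu.2.trans h⟩, hu.2⟩⟩

end Height

section Size

variable {S T T' : PlanarTree} {r N : ℕ}

theorem size_eq_encard_verts (T : PlanarTree) : T.size = (T.verts \ {[]}).encard := by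
  have hinj : Function.Injective fun v : List ℕ ↦ (v.dropLast, v) :=
    fun v w h ↦ (Prod.mk.inj h).2
  rw [size, ← hinj.encard_image]
  congr 1
  ext ⟨u, v⟩
  simp only [edges, Set.mem_ofPred_eq, Set.mem_image, Set.mem_sdiff, Set.mem_singleton_iff,
    Prod.mk.injEq]
  constructor
  · rintro ⟨hv, n, rfl⟩
    exact ⟨u ++ [n], ⟨hv, by simp⟩, by simp, rfl⟩
  · rintro ⟨w, ⟨hw, hne⟩, rfl, rfl⟩
    exact ⟨hw, w.getLast hne, (List.dropLast_append_getLast hne).symm⟩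

theorem size_le_size (h : T.verts ⊆ T'.verts) : T.size ≤ T'.size := by
  rw [size_eq_encard_verts, size_eq_encard_verts]
  exact Set.encard_le_encard (Set.sdiff_subset_sdiff_left h)

theorem HeightLE.size_ne_top (h : T.HeightLE r) : T.size ≠ ⊤ := by
  rw [size_eq_encard_verts]
  exact Set.encard_ne_top_iff.2 (h.verts_finite.subset Set.sdiff_subset)

theorem HeightLE.natCast_toNat_size (h : T.HeightLE r) : (T.size.toNat : ℕ∞) = T.size :=
  ENat.natCast_toNat h.size_ne_top

theorem HeightLE.isFinite (h : T.HeightLE r) : T.IsFinite :=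
  Set.encard_ne_top_iff.1 h.size_ne_top

theorem HeightLE.one_le_size (h : T.HeightLE r) : 1 ≤ T.size.toNat := by
  have hchild : ({[0]} : Set (List ℕ)) ⊆ T.verts \ {[]} := by
    rintro _ rfl
    exact ⟨(T.singleton_mem_iff 0).2 rfl, by simp⟩
  have hle := Set.encard_le_encard hchild
  rw [← size_eq_encard_verts, Set.encard_singleton, ← h.natCast_toNat_size] at hle
  exact_mod_cast hle

theorem HeightLE.size_eq_add_card_levelFinset (hS : S.HeightLE (r + 1))
    (h : S.rootBall r = T.verts) : S.size = T.size + (S.levelFinset (r + 1)).card := by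
  have hverts : S.verts \ {[]} = T.verts \ {[]} ∪ S.levelFinset (r + 1) := by
    ext u
    have hu : u ∈ S.verts → u.length ≤ r + 1 := hS u
    simp only [← h, Set.mem_union, Set.mem_sdiff, mem_rootBall, Set.mem_singleton_iff,
      Finset.mem_coe, mem_levelFinset, ← List.length_eq_zero_iff]
    grind
  have hdisj : Disjoint (T.verts \ {[]}) (S.levelFinset (r + 1) : Set (List ℕ)) := by
    refine Set.disjoint_left.2 fun u hu hu' ↦ ?_
    have hle : u.length ≤ r := (h.ge hu.1).2
    have heq := (mem_levelFinset.1 hu').2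
    omega
  rw [size_eq_encard_verts, size_eq_encard_verts, hverts, Set.encard_union_eq hdisj,
    Set.encard_coe_eq_coe_finsetCard]

@[simp]
theorem mem_treeFinset : T ∈ treeFinset N ↔ T.size = N := by
  simp only [treeFinset, treesOfSize, Set.Finite.mem_toFinset, Set.mem_ofPred_eq]

end Size

end PlanarTree

namespace PlanarTree

section Forests

open Finset PowerSeries

/-- `forestWeight q K n` is the total weight `∑ q ^ h` of the planar forests with `K` roots and
`n` edges, `h` being the height of the forest. The recursion removes the roots: `j + 1` vertices
at distance one from the roots can be distributed among them in `multichoose K (j + 1)` ways. -/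
noncomputable def forestWeight (q : ℝ) : ℕ → ℕ → ℝ
  | _, 0 => 1
  | K, n + 1 =>
    q * ∑ j ∈ range (n + 1), (K.multichoose (j + 1) : ℝ) * forestWeight q (j + 1) (n - j)
termination_by _ n => n

@[simp]
theorem forestWeight_zero_right (q : ℝ) (K : ℕ) : forestWeight q K 0 = 1 := by
  rw [forestWeight]

theorem forestWeight_succ (q : ℝ) (K n : ℕ) : forestWeight q K (n + 1) =
    q * ∑ j ∈ range (n + 1), (K.multichoose (j + 1) : ℝ) * forestWeight q (j + 1) (n - j) := by
  rw [forestWeight]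

theorem hasSum_multichoose_mul_pow (K : ℕ) {x : ℝ} (hx : |x| < 1) :
    HasSum (fun j ↦ (K.multichoose j : ℝ) * x ^ j) ((1 - x)⁻¹ ^ K) := by
  rcases K with _ | K
  · convert hasSum_single (f := fun j ↦ (Nat.multichoose 0 j : ℝ) * x ^ j) 0 fun j hj ↦ ?_
    · simp
    · obtain ⟨i, rfl⟩ := Nat.exists_eq_succ_of_ne_zero hj
      simp
  · have h := hasSum_choose_mul_geometric_of_norm_lt_one K (r := x) (by simpa using hx)
    rw [one_div, ← inv_pow] at h
    refine h.congr_fun fun j ↦ ?_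
    rw [Nat.multichoose_eq, add_right_comm, Nat.add_sub_cancel, add_comm K, Nat.choose_symm_add]

theorem sum_multichoose_mul_two_pow_mul_four_pow_le (K n : ℕ) :
    ∑ j ∈ range (n + 1), (K.multichoose j : ℝ) * (2 ^ j * 4 ^ (n - j)) ≤ 2 ^ K * 4 ^ n := by
  have hsum := hasSum_multichoose_mul_pow K (x := 1 / 2) (by norm_num [abs_of_pos])
  have hle := hsum.summable.sum_le_tsum (range (n + 1)) fun j _ ↦ by positivity
  rw [hsum.tsum_eq] at hle
  calc ∑ j ∈ range (n + 1), (K.multichoose j : ℝ) * (2 ^ j * 4 ^ (n - j))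
      = (∑ j ∈ range (n + 1), (K.multichoose j : ℝ) * (1 / 2) ^ j) * 4 ^ n := by
        rw [sum_mul]
        refine sum_congr rfl fun j hj ↦ ?_
        rw [← Nat.sub_add_cancel (Nat.lt_succ_iff.1 (mem_range.1 hj)), pow_add, Nat.add_sub_cancel,
          show (4 : ℝ) ^ j = 2 ^ j * 2 ^ j by rw [← mul_pow]; norm_num]
        rw [one_div, inv_pow]
        field_simp
    _ ≤ (1 - 1 / 2)⁻¹ ^ K * 4 ^ n := by gcongr
    _ = 2 ^ K * 4 ^ n := by norm_num

variable {q : ℝ}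

theorem forestWeight_nonneg (hq : 0 ≤ q) (K n : ℕ) : 0 ≤ forestWeight q K n := by
  induction n using Nat.strong_induction_on generalizing K with
  | _ n ih =>
    rcases n with _ | n
    · simp
    · rw [forestWeight_succ]
      exact mul_nonneg hq (sum_nonneg fun j _ ↦ mul_nonneg (Nat.cast_nonneg _) (ih _ (by omega) _))

theorem forestWeight_pos (hq : 0 < q) (K n : ℕ) : 0 < forestWeight q (K + 1) n := by
  induction n generalizing K with
  | zero => simp
  | succ n ih =>
    rw [forestWeight_succ]
    refine mul_pos hq (sum_pos' (fun j _ ↦ mul_nonneg (Nat.cast_nonneg _)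
      (forestWeight_nonneg hq.le _ _)) ⟨0, by simp, ?_⟩)
    simpa using mul_pos (by positivity : (0 : ℝ) < K + 1) (ih 0)

theorem forestWeight_le (hq₀ : 0 ≤ q) (hq₁ : q ≤ 1) (K n : ℕ) :
    forestWeight q K n ≤ 2 ^ K * 4 ^ n := by
  induction n using Nat.strong_induction_on generalizing K with
  | _ n ih =>
    rcases n with _ | n
    · simpa using one_le_pow₀ (one_le_two : (1 : ℝ) ≤ 2)
    · calc forestWeight q K (n + 1)
          ≤ ∑ j ∈ range (n + 1), (K.multichoose (j + 1) : ℝ) * forestWeight q (j + 1) (n - j) := by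
            rw [forestWeight_succ]
            exact mul_le_of_le_one_left (sum_nonneg fun j _ ↦ mul_nonneg (Nat.cast_nonneg _)
              (forestWeight_nonneg hq₀ _ _)) hq₁
        _ ≤ ∑ j ∈ range (n + 1), (K.multichoose (j + 1) : ℝ) * (2 ^ (j + 1) * 4 ^ (n - j)) := by
            gcongr with j
            exact ih _ (by omega) _
        _ ≤ ∑ j ∈ range (n + 2), (K.multichoose j : ℝ) * (2 ^ j * 4 ^ (n + 1 - j)) := by
            rw [sum_range_succ' _ (n + 1)]
            simp only [Nat.add_sub_add_right]
            exact le_add_of_nonneg_right (by positivity)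
        _ ≤ 2 ^ K * 4 ^ (n + 1) := sum_multichoose_mul_two_pow_mul_four_pow_le K (n + 1)

/-- `treeSeries m` is the generating function, by number of edges, of the planar trees of height
less than `m`. -/
noncomputable def treeSeries : ℕ → ℝ⟦X⟧
  | 0 => 0
  | m + 1 => (1 - X * treeSeries m)⁻¹

theorem X_pow_dvd_sum_multichoose_mul_pow_sub_one {g : ℝ⟦X⟧} (hg : X ∣ g) (n K : ℕ) :
    X ^ (n + 1) ∣ (∑ j ∈ range (n + 1), (K.multichoose j : ℝ⟦X⟧) * g ^ j) * (1 - g) ^ K - 1 := by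
  induction K with
  | zero => simp [sum_range_succ']
  | succ K ih =>
    have hstep : (∑ j ∈ range (n + 1), ((K + 1).multichoose j : ℝ⟦X⟧) * g ^ j) * (1 - g) =
        (∑ j ∈ range (n + 1), (K.multichoose j : ℝ⟦X⟧) * g ^ j) -
          (K + 1).multichoose n * g ^ (n + 1) := by
      clear ih
      induction n with
      | zero => simp
      | succ n ih =>
        rw [sum_range_succ, add_mul, ih, sum_range_succ _ (n + 1), Nat.multichoose_succ_succ]
        push_cast
        ring
    have hsplit : (∑ j ∈ range (n + 1), ((K + 1).multichoose j : ℝ⟦X⟧) * g ^ j) *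
          (1 - g) ^ (K + 1) - 1 =
        ((∑ j ∈ range (n + 1), (K.multichoose j : ℝ⟦X⟧) * g ^ j) * (1 - g) ^ K - 1) -
          g ^ (n + 1) * ((K + 1).multichoose n * (1 - g) ^ K) := by
      linear_combination (1 - g) ^ K * hstep
    rw [hsplit]
    exact dvd_sub ih ((pow_dvd_pow_of_dvd hg _).mul_right _)

theorem coeff_inv_one_sub_pow {g : ℝ⟦X⟧} (hg : X ∣ g) (n K : ℕ) :
    coeff n ((1 - g)⁻¹ ^ K) = ∑ j ∈ range (n + 1), (K.multichoose j : ℝ) * coeff n (g ^ j) := by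
  have hinv : (1 - g) * (1 - g)⁻¹ = 1 := PowerSeries.mul_inv_cancel _ (by
    simp [X_dvd_iff.1 hg])
  have hdvd := (X_pow_dvd_sum_multichoose_mul_pow_sub_one hg n K).mul_right ((1 - g)⁻¹ ^ K)
  rw [sub_mul, mul_assoc, ← mul_pow, hinv, one_pow, mul_one, one_mul] at hdvd
  have h := X_pow_dvd_iff.1 hdvd n n.lt_succ_self
  rw [map_sub, sub_eq_zero] at h
  rw [← h, map_sum]
  refine sum_congr rfl fun j _ ↦ ?_
  rw [← nsmul_eq_mul, map_nsmul, nsmul_eq_mul]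

theorem coeff_treeSeries_succ_pow (m K n : ℕ) : coeff n (treeSeries (m + 1) ^ K) =
    ∑ j ∈ range (n + 1), (K.multichoose j : ℝ) * coeff (n - j) (treeSeries m ^ j) := by
  rw [treeSeries, coeff_inv_one_sub_pow (dvd_mul_right X _)]
  refine sum_congr rfl fun j hj ↦ ?_
  rw [mul_pow, coeff_X_pow_mul', if_pos (Nat.lt_succ_iff.1 (mem_range.1 hj))]

theorem coeff_treeSeries_pow_nonneg (m K n : ℕ) : 0 ≤ coeff n (treeSeries m ^ K) := by
  induction m generalizing K n with
  | zero =>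
    rw [treeSeries, zero_pow_eq]
    split_ifs <;> simp [coeff_one, apply_ite]
  | succ m ih =>
    rw [coeff_treeSeries_succ_pow]
    exact sum_nonneg fun j _ ↦ mul_nonneg (Nat.cast_nonneg _) (ih _ _)

theorem coeff_zero_treeSeries_succ_pow (m K : ℕ) : coeff 0 (treeSeries (m + 1) ^ K) = 1 := by
  simp [coeff_treeSeries_succ_pow]

theorem hasSum_coeff_treeSeries_pow (hq₀ : 0 ≤ q) (hq₁ : q < 1) (K n : ℕ) :
    HasSum (fun m ↦ (1 - q) * q ^ m * coeff n (treeSeries (m + 1) ^ K)) (forestWeight q K n) := by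
  induction n using Nat.strong_induction_on generalizing K with
  | _ n ih =>
    rcases n with _ | n
    · simpa [coeff_zero_treeSeries_succ_pow, sub_ne_zero.2 hq₁.ne'] using
        (hasSum_geometric_of_lt_one hq₀ hq₁).mul_left (1 - q)
    · have hfirst : coeff (n + 1) (treeSeries 1 ^ K) = 0 := by
        simp [treeSeries, coeff_one]
      have hrest := (hasSum_sum (s := range (n + 1)) fun j _ ↦
        (ih (n - j) (by omega) (j + 1)).mul_left (K.multichoose (j + 1) : ℝ)).mul_left q
      rw [← forestWeight_succ] at hrest
      rw [← hasSum_nat_add_iff' 1]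
      simp only [range_one, sum_singleton, zero_add, hfirst, mul_zero, sub_zero]
      refine hrest.congr_fun fun m ↦ ?_
      rw [coeff_treeSeries_succ_pow, sum_range_succ']
      simp only [mul_sum, pow_zero, coeff_one, Nat.sub_zero, n.succ_ne_zero, if_false, mul_zero,
        add_zero, Nat.add_sub_add_right, pow_succ]
      exact sum_congr rfl fun j _ ↦ by ring

end Forests
end PlanarTree

namespace PlanarTree

section Extensions

variable {S T T' : PlanarTree} {r j : ℕ}

/-- Every vertex `u` of `T` at distance `r` from the root is given `f u` children, in addition to
those which it has already. -/
def extend (T : PlanarTree) (r : ℕ) (hr : 1 ≤ r) (f : List ℕ → ℕ) : PlanarTree where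
  verts := T.verts ∪ {v | ∃ u n, v = u ++ [n] ∧ u ∈ T.level r ∧ n < f u}
  root_mem := Or.inl T.root_mem
  singleton_mem_iff n := by
    refine ⟨?_, fun h ↦ Or.inl ((T.singleton_mem_iff n).2 h)⟩
    rintro (h | ⟨u, m, h, hu, -⟩)
    · exact (T.singleton_mem_iff n).1 h
    · have hlen := congrArg List.length h
      simp only [List.length_append, List.length_singleton, hu.2] at hlen
      omega
  parent_mem u n h := by
    rcases h with h | ⟨v, m, h, hv, -⟩
    · exact Or.inl (T.parent_mem u n h)
    · rw [(List.append_inj' h rfl).1]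
      exact Or.inl hv.1
  sibling_mem u m n hmn h := by
    rcases h with h | ⟨v, k, h, hv, hk⟩
    · exact Or.inl (T.sibling_mem u m n hmn h)
    · obtain ⟨rfl, hnk⟩ := List.append_inj' h rfl
      obtain rfl : n = k := by simpa using hnk
      exact Or.inr ⟨u, m, rfl, hv, hmn.trans_lt hk⟩
  locally_finite u := by
    refine ((T.locally_finite u).union (Set.finite_Iio (f u))).subset fun n h ↦ ?_
    rcases h with h | ⟨v, k, h, -, hk⟩
    · exact Or.inl h
    · obtain ⟨rfl, hnk⟩ := List.append_inj' h rfl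
      obtain rfl : n = k := by simpa using hnk
      exact Or.inr hk

theorem HeightLE.extend (hT : T.HeightLE r) (hr : 1 ≤ r) (f : List ℕ → ℕ) :
    (T.extend r hr f).HeightLE (r + 1) := by
  rintro v (h | ⟨u, n, rfl, hu, -⟩)
  · exact (hT v h).trans r.le_succ
  · simp [hu.2]

theorem HeightLE.rootBall_extend (hT : T.HeightLE r) (hr : 1 ≤ r) (f : List ℕ → ℕ) :
    (T.extend r hr f).rootBall r = T.verts := by
  ext v
  refine ⟨?_, fun hv ↦ ⟨Or.inl hv, hT v hv⟩⟩
  rintro ⟨hv | ⟨u, n, rfl, hu, -⟩, hle⟩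
  · exact hv
  · simp [hu.2] at hle

theorem HeightLE.childCount_extend (hT : T.HeightLE r) (hr : 1 ≤ r) (f : List ℕ → ℕ)
    {u : List ℕ} (hu : u ∈ T.levelFinset r) : (T.extend r hr f).childCount u = f u := by
  rw [mem_levelFinset] at hu
  refine eq_of_forall_lt_iff fun n ↦ ?_
  rw [← append_singleton_mem_iff]
  constructor
  · rintro (h | ⟨v, m, h, -, hm⟩)
    · have hle := hT _ h
      simp [hu.2] at hle
    · obtain ⟨rfl, hnm⟩ := List.append_inj' h rfl
      obtain rfl : n = m := by simpa using hnm
      exact hm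
  · exact fun h ↦ Or.inr ⟨u, n, rfl, hu, h⟩

theorem HeightLE.card_levelFinset_extend (hT : T.HeightLE r) (hr : 1 ≤ r) (f : List ℕ → ℕ) :
    ((T.extend r hr f).levelFinset (r + 1)).card = ∑ u ∈ T.levelFinset r, f u := by
  rw [card_levelFinset_succ, hT.levelFinset_eq (hT.rootBall_extend hr f)]
  exact Finset.sum_congr rfl fun u hu ↦ hT.childCount_extend hr f hu

theorem HeightLE.extend_eq (hS : S.HeightLE (r + 1)) (h : S.rootBall r = T.verts) (hr : 1 ≤ r)
    {f : List ℕ → ℕ} (hf : ∀ u ∈ T.levelFinset r, f u = S.childCount u) :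
    T.extend r hr f = S := by
  refine PlanarTree.ext (Set.Subset.antisymm ?_ fun v hv ↦ ?_)
  · rintro v (hv | ⟨u, n, rfl, hu, hn⟩)
    · exact verts_subset_of_rootBall_eq h hv
    · rwa [append_singleton_mem_iff, ← hf u (mem_levelFinset.2 hu)]
  · rcases (hS v hv).lt_or_eq with hlt | heq
    · exact Or.inl (h.le ⟨hv, Nat.le_of_lt_succ hlt⟩)
    · obtain ⟨u, n, rfl⟩ := (List.eq_nil_or_concat' v).resolve_left (by rintro rfl; simp at heq)
      have hu : u.length = r := by simpa using heq
      have hmem : u ∈ T.levelFinset r :=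
        mem_levelFinset.2 ⟨h.le ⟨S.parent_mem u n hv, hu.le⟩, hu⟩
      exact Or.inr ⟨u, n, rfl, mem_levelFinset.1 hmem,
        (hf u hmem).symm ▸ (S.append_singleton_mem_iff u n).1 hv⟩

open Classical in
/-- The trees of size `N` whose ball of radius `r` is `T`. -/
noncomputable def treesOver (T : PlanarTree) (r N : ℕ) : Finset PlanarTree :=
  {T' ∈ treeFinset N | T'.rootBall r = T.verts}

theorem mem_treesOver {N : ℕ} : T' ∈ T.treesOver r N ↔ T'.size = N ∧ T'.rootBall r = T.verts := by
  simp only [treesOver, Finset.mem_filter, mem_treeFinset]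

open Classical in
/-- The trees obtained from a tree `T` of height at most `r` by adding `j` vertices at distance
`r + 1` from the root. -/
noncomputable def extensions (T : PlanarTree) (r j : ℕ) : Finset PlanarTree :=
  {S ∈ T.treesOver r (T.size.toNat + j) | S.HeightLE (r + 1)}

theorem HeightLE.mem_extensions (hT : T.HeightLE r) : S ∈ T.extensions r j ↔
    S.HeightLE (r + 1) ∧ S.rootBall r = T.verts ∧ (S.levelFinset (r + 1)).card = j := by
  have hcard (hS : S.HeightLE (r + 1)) (hball : S.rootBall r = T.verts) :
      S.size = T.size + j ↔ (S.levelFinset (r + 1)).card = j := by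
    rw [hS.size_eq_add_card_levelFinset hball,
      (ENat.add_right_injective_of_ne_top hT.size_ne_top).eq_iff, Nat.cast_inj]
  simp only [extensions, Finset.mem_filter, mem_treesOver, Nat.cast_add, hT.natCast_toNat_size]
  tauto

theorem size_of_mem_extensions (hS : S ∈ T.extensions r j) : S.size = (T.size.toNat + j : ℕ) := by
  classical exact (mem_treesOver.1 (Finset.mem_filter.1 hS).1).1

theorem HeightLE.height_of_mem_extensions_succ (hT : T.HeightLE r)
    (hS : S ∈ T.extensions r (j + 1)) : S.height = (r + 1 : ℕ) := by
  obtain ⟨hheight, -, hcard⟩ := hT.mem_extensions.1 hS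
  exact (height_eq_iff r.succ_pos).2 ⟨hheight, Finset.card_pos.1 (hcard ▸ j.succ_pos)⟩

theorem HeightLE.card_extensions (hT : T.HeightLE r) (hr : 1 ≤ r) (j : ℕ) :
    (T.extensions r j).card = (T.levelFinset r).card.multichoose j := by
  rw [← Finset.card_finsuppAntidiag_nat_eq_multichoose]
  symm
  refine Finset.card_bij (fun f _ ↦ T.extend r hr f) (fun f hf ↦ ?_) (fun f hf g hg hfg ↦ ?_)
    fun S hS ↦ ?_
  · rw [hT.mem_extensions, hT.card_levelFinset_extend hr f]
    exact ⟨hT.extend hr f, hT.rootBall_extend hr f, (Finset.mem_finsuppAntidiag.1 hf).1⟩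
  · ext u
    by_cases hu : u ∈ T.levelFinset r
    · rw [← hT.childCount_extend hr f hu, hfg, hT.childCount_extend hr g hu]
    · rw [Finsupp.notMem_support_iff.1 fun h ↦ hu ((Finset.mem_finsuppAntidiag.1 hf).2 h),
        Finsupp.notMem_support_iff.1 fun h ↦ hu ((Finset.mem_finsuppAntidiag.1 hg).2 h)]
  · obtain ⟨hheight, hball, rfl⟩ := hT.mem_extensions.1 hS
    have happly : ∀ u ∈ T.levelFinset r,
        Finsupp.indicator (T.levelFinset r) (fun u _ ↦ S.childCount u) u = S.childCount u :=
      fun u hu ↦ Finsupp.indicator_of_mem hu _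
    refine ⟨Finsupp.indicator (T.levelFinset r) fun u _ ↦ S.childCount u,
      Finset.mem_finsuppAntidiag.2 ⟨?_, Finsupp.support_indicator_subset ..⟩,
      hheight.extend_eq hball hr happly⟩
    rw [Finset.sum_congr rfl happly, card_levelFinset_succ, hT.levelFinset_eq hball]

theorem HeightLE.eq_of_mem_extensions (hT : T.HeightLE r) (hT' : T'.HeightLE r) {j' : ℕ}
    (hS : S ∈ T.extensions r j) (hS' : S ∈ T'.extensions r j') : T = T' ∧ j = j' := by
  obtain ⟨-, hball, hcard⟩ := hT.mem_extensions.1 hS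
  obtain ⟨-, hball', hcard'⟩ := hT'.mem_extensions.1 hS'
  exact ⟨PlanarTree.ext (hball.symm.trans hball'), hcard.symm.trans hcard'⟩

end Extensions

section Weights

variable {T T' : PlanarTree} {r : ℕ}

theorem weight_eq_of_height_eq (μ : ℝ) (hT : T.height = r) : weight μ T = Real.exp (-μ) ^ r := by
  rw [weight, hT, ENat.toNat_natCast, mul_comm, Real.exp_nat_mul]

theorem HeightLE.size_add_card_levelFinset_le (hT : T.HeightLE r) (h : T'.rootBall r = T.verts) :
    T.size.toNat + (T'.levelFinset (r + 1)).card ≤ T'.size := by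
  have hball : (T'.trunc (r + 1) r.succ_pos).rootBall r = T.verts :=
    (T'.rootBall_trunc _ r.le_succ).trans h
  rw [← levelFinset_eq_of_rootBall_eq (T'.rootBall_trunc r.succ_pos le_rfl), hT.natCast_toNat_size,
    ← (T'.trunc_heightLE r.succ_pos).size_eq_add_card_levelFinset hball]
  exact size_le_size fun _ hu ↦ hu.1

theorem HeightLE.treesOver_size (hT : T.HeightLE r) : T.treesOver r T.size.toNat = {T} := by
  ext T'
  rw [mem_treesOver, Finset.mem_singleton]
  refine ⟨fun ⟨hsize, hball⟩ ↦ ?_, ?_⟩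
  · have hle := hT.size_add_card_levelFinset_le hball
    rw [hsize, ← Nat.cast_add, Nat.cast_le, add_le_iff_nonpos_right, Nat.le_zero,
      Finset.card_eq_zero] at hle
    exact (heightLE_of_levelFinset_succ_eq_empty hle).eq_of_rootBall_eq hball
  · rintro rfl
    exact ⟨hT.natCast_toNat_size.symm, hT.rootBall_eq⟩

theorem HeightLE.exists_trunc_mem_extensions (hT : T.HeightLE r) {n : ℕ}
    (hT' : T' ∈ T.treesOver r (T.size.toNat + (n + 1))) :
    ∃ j ∈ Finset.range (n + 1), T'.trunc (r + 1) r.succ_pos ∈ T.extensions r (j + 1) := by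
  obtain ⟨hsize, hball⟩ := mem_treesOver.1 hT'
  have hpos : (T'.levelFinset (r + 1)).card ≠ 0 := fun hzero ↦ by
    have heq := (heightLE_of_levelFinset_succ_eq_empty
      (Finset.card_eq_zero.1 hzero)).eq_of_rootBall_eq hball
    rw [heq] at hsize
    have htoNat := congrArg ENat.toNat hsize
    rw [ENat.toNat_natCast] at htoNat
    omega
  have hle := hT.size_add_card_levelFinset_le hball
  rw [hsize, ← Nat.cast_add, Nat.cast_le] at hle
  refine ⟨(T'.levelFinset (r + 1)).card - 1, Finset.mem_range.2 (by omega),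
    hT.mem_extensions.2 ⟨T'.trunc_heightLE r.succ_pos,
      (T'.rootBall_trunc _ r.le_succ).trans hball, ?_⟩⟩
  rw [levelFinset_eq_of_rootBall_eq (T'.rootBall_trunc r.succ_pos le_rfl), Nat.sub_add_cancel]
  omega

theorem HeightLE.sum_treesOver (hT : T.HeightLE r) (n : ℕ) (g : PlanarTree → ℝ) :
    ∑ T' ∈ T.treesOver r (T.size.toNat + (n + 1)), g T' =
      ∑ j ∈ Finset.range (n + 1), ∑ S ∈ T.extensions r (j + 1),
        ∑ T' ∈ S.treesOver (r + 1) (T.size.toNat + (n + 1)), g T' := by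
  classical
  have hdisj : Set.PairwiseDisjoint (Finset.range (n + 1) : Set ℕ)
      fun j ↦ T.extensions r (j + 1) := fun i _ j _ hij ↦
    Finset.disjoint_left.2 fun S hi hj ↦ hij (by simpa using (hT.eq_of_mem_extensions hT hi hj).2)
  rw [← Finset.sum_biUnion hdisj, ← Finset.sum_fiberwise_of_maps_to
    (g := fun T' : PlanarTree ↦ T'.trunc (r + 1) r.succ_pos)
    fun T' hT' ↦ Finset.mem_biUnion.2 (hT.exists_trunc_mem_extensions hT')]
  refine Finset.sum_congr rfl fun S hS ↦ Finset.sum_congr ?_ fun _ _ ↦ rfl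
  obtain ⟨j, -, hS⟩ := Finset.mem_biUnion.1 hS
  obtain ⟨hheight, hball, -⟩ := hT.mem_extensions.1 hS
  ext T'
  rw [Finset.mem_filter, mem_treesOver, mem_treesOver, and_assoc, PlanarTree.ext_iff]
  refine and_congr_right fun _ ↦ ⟨fun h ↦ h.2, fun h ↦ ⟨?_, h⟩⟩
  exact (rootBall_eq_of_le r.le_succ (h.trans hheight.rootBall_eq.symm)).trans hball

theorem sum_treesOver_weight (μ : ℝ) (hr : 1 ≤ r) (hT : T.height = r) (n : ℕ) :
    ∑ T' ∈ T.treesOver r (T.size.toNat + n), weight μ T' =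
      Real.exp (-μ) ^ r * forestWeight (Real.exp (-μ)) (T.levelFinset r).card n := by
  induction n using Nat.strong_induction_on generalizing T r with
  | _ n ih =>
  have hTle := heightLE_of_height_eq hT
  rcases n with _ | n
  · rw [Nat.add_zero, hTle.treesOver_size, Finset.sum_singleton, weight_eq_of_height_eq μ hT,
      forestWeight_zero_right, mul_one]
  have hext : ∀ j ∈ Finset.range (n + 1), ∀ S ∈ T.extensions r (j + 1),
      ∑ T' ∈ S.treesOver (r + 1) (T.size.toNat + (n + 1)), weight μ T' =
        Real.exp (-μ) ^ (r + 1) * forestWeight (Real.exp (-μ)) (j + 1) (n - j) := by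
    intro j hj S hS
    have hsize : S.size.toNat = T.size.toNat + (j + 1) := by
      rw [size_of_mem_extensions hS, ENat.toNat_natCast]
    rw [← (hTle.mem_extensions.1 hS).2.2,
      ← ih (n - j) (by omega) r.succ_pos (hTle.height_of_mem_extensions_succ hS), hsize,
      show T.size.toNat + (j + 1) + (n - j) = T.size.toNat + (n + 1) by
        have := Finset.mem_range.1 hj
        omega]
  rw [hTle.sum_treesOver, forestWeight_succ, Finset.mul_sum, Finset.mul_sum]
  refine Finset.sum_congr rfl fun j hj ↦ ?_
  rw [Finset.sum_congr rfl (hext j hj), Finset.sum_const, hTle.card_extensions hr, nsmul_eq_mul]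
  ring

theorem path_one_height : (path 1 le_rfl).height = (1 : ℕ) :=
  (height_eq_iff le_rfl).2 ⟨fun _ hu ↦ hu.1, [0], by simp [path]⟩

theorem levelFinset_one (T : PlanarTree) : T.levelFinset 1 = {[0]} := by
  ext u
  rw [mem_levelFinset, Finset.mem_singleton]
  refine ⟨fun ⟨hu, hlen⟩ ↦ ?_, by rintro rfl; exact ⟨(T.singleton_mem_iff 0).2 rfl, rfl⟩⟩
  obtain ⟨n, rfl⟩ := List.length_eq_one_iff.1 hlen
  rw [(T.singleton_mem_iff n).1 hu]

theorem size_path_one : (path 1 le_rfl).size = (1 : ℕ) := path_mem 1 le_rfl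

theorem partitionFunction_succ (μ : ℝ) (n : ℕ) : partitionFunction μ (n + 1) =
    Real.exp (-μ) * forestWeight (Real.exp (-μ)) 1 n := by
  have hsum := sum_treesOver_weight μ le_rfl path_one_height n
  rw [levelFinset_one, Finset.card_singleton, pow_one, size_path_one, ENat.toNat_natCast,
    add_comm 1] at hsum
  rw [← hsum, partitionFunction]
  refine Finset.sum_congr (Finset.ext fun T ↦ ?_) fun _ _ ↦ rfl
  rw [mem_treeFinset, mem_treesOver, ← (heightLE_of_height_eq path_one_height).rootBall_eq,
    and_iff_left (rootBall_one_eq _ _)]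

end Weights

end PlanarTree

/-- A positive sequence with `u (n + 1) ^ 2 ≤ u n * u (n + 2)`, encoded by the monotonicity of its
ratios. -/
structure LogConvexSeq (u : ℕ → ℝ) : Prop where
  pos : ∀ n, 0 < u n
  ratio_mono : Monotone fun n ↦ u (n + 1) / u n

namespace LogConvexSeq

open Finset

variable {u f : ℕ → ℝ}

theorem of_sq_le (hu : ∀ n, 0 < u n) (h : ∀ n, u (n + 1) ^ 2 ≤ u n * u (n + 2)) :
    LogConvexSeq u := by
  refine ⟨hu, monotone_nat_of_le_succ fun n ↦ ?_⟩
  rw [div_le_div_iff₀ (hu n) (hu (n + 1))]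
  linarith [h n]

theorem of_quadratic_nonneg (hu : ∀ n, 0 < u n)
    (h : ∀ n t, 0 ≤ t ^ 2 * u n - 2 * t * u (n + 1) + u (n + 2)) : LogConvexSeq u := by
  refine of_sq_le hu fun n ↦ ?_
  have hn := mul_nonneg (hu n).le (h n (u (n + 1) / u n))
  have hne := (hu n).ne'
  field_simp at hn
  nlinarith

theorem mul_le_mul (hu : LogConvexSeq u) {k n : ℕ} (hkn : k ≤ n) :
    u (k + 1) * u n ≤ u k * u (n + 1) := by
  have h := hu.ratio_mono hkn
  simp only [div_le_div_iff₀ (hu.pos k) (hu.pos n)] at h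
  linarith

theorem quadratic_nonneg (hu : LogConvexSeq u) (n : ℕ) (t : ℝ) :
    0 ≤ t ^ 2 * u n - 2 * t * u (n + 1) + u (n + 2) := by
  have hsq := hu.mul_le_mul n.le_succ
  refine nonneg_of_mul_nonneg_right (a := u n) ?_ (hu.pos n)
  nlinarith [sq_nonneg (t * u n - u (n + 1))]

theorem const_mul (hu : LogConvexSeq u) {c : ℝ} (hc : 0 < c) : LogConvexSeq fun n ↦ c * u n :=
  ⟨fun n ↦ mul_pos hc (hu.pos n), by simpa only [mul_div_mul_left _ _ hc.ne'] using hu.ratio_mono⟩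

theorem renewal_sq_le (hf : LogConvexSeq f)
    (hu : ∀ n, u (n + 1) = ∑ k ∈ range (n + 1), f k * u (n - k)) (n : ℕ)
    (hle : ∀ k ≤ n, u (k + 1) * u n ≤ u k * u (n + 1)) : u (n + 1) ^ 2 ≤ u n * u (n + 2) := by
  rcases n with _ | n
  · have h₁ := hu 0
    have h₂ := hu 1
    simp only [sum_range_succ, range_zero, sum_empty, zero_add, Nat.sub_zero, Nat.sub_self] at h₁ h₂
    linear_combination u 1 * h₁ - u 0 * h₂ + mul_nonneg (hf.pos 1).le (sq_nonneg (u 0))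
  set e : ℕ → ℝ := fun k ↦ u (n + 1 - k) * u (n + 1) - u (n + 2) * u (n - k) with he
  have hterm : f (n + 2) * ∑ k ∈ range (n + 1), f k * e k ≤
      f (n + 1) * ∑ k ∈ range (n + 1), f (k + 1) * e k := by
    rw [mul_sum, mul_sum]
    refine sum_le_sum fun k hk ↦ ?_
    have hkn : k ≤ n := Nat.lt_succ_iff.1 (mem_range.1 hk)
    have hek : e k ≤ 0 := by
      have := hle (n - k) (by omega)
      rw [← Nat.sub_add_comm hkn] at this
      linarith
    nlinarith [mul_le_mul_of_nonpos_right (hf.mul_le_mul (hkn.trans n.le_succ)) hek]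
  have hexpand : ∀ g : ℕ → ℝ, ∑ k ∈ range (n + 1), g k * e k =
      (∑ k ∈ range (n + 1), g k * u (n + 1 - k)) * u (n + 1) -
        u (n + 2) * ∑ k ∈ range (n + 1), g k * u (n - k) := fun g ↦ by
    rw [sum_mul, mul_sum, ← sum_sub_distrib]
    exact sum_congr rfl fun k _ ↦ by rw [he]; ring
  have hlow : u (n + 2) = ∑ k ∈ range (n + 1), f k * u (n + 1 - k) + f (n + 1) * u 0 := by
    rw [hu (n + 1), sum_range_succ, Nat.sub_self]
  have hhigh : u (n + 3) = ∑ k ∈ range (n + 1), f (k + 1) * u (n + 1 - k) + f 0 * u (n + 2) +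
      f (n + 2) * u 0 := by
    rw [hu (n + 2), sum_range_succ, sum_range_succ', Nat.sub_self, Nat.sub_zero]
    simp only [Nat.reduceSubDiff]
  have hmid : u (n + 2) = ∑ k ∈ range (n + 1), f (k + 1) * u (n - k) + f 0 * u (n + 1) := by
    rw [hu (n + 1), sum_range_succ', Nat.sub_zero]
    simp only [Nat.add_sub_add_right]
  rw [hexpand, hexpand, ← hu n] at hterm
  refine sub_nonneg.1 (nonneg_of_mul_nonneg_right (a := f (n + 1)) ?_ (hf.pos _))
  linear_combination hterm + f (n + 2) * u (n + 1) * hlow + f (n + 1) * u (n + 2) * hmid -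
    f (n + 1) * u (n + 1) * hhigh

theorem renewal (hf : LogConvexSeq f) (hu₀ : 0 < u 0)
    (hu : ∀ n, u (n + 1) = ∑ k ∈ range (n + 1), f k * u (n - k)) : LogConvexSeq u := by
  have hpos : ∀ n, 0 < u n := fun n ↦ by
    induction n using Nat.strong_induction_on with
    | _ n ih =>
      rcases n with _ | n
      · exact hu₀
      · rw [hu]
        exact sum_pos (fun k _ ↦ mul_pos (hf.pos k) (ih _ (by omega))) (by simp)
  have hle : ∀ n, ∀ k ≤ n, u (k + 1) * u n ≤ u k * u (n + 1) := fun n ↦ by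
    induction n with
    | zero => intro k hk; rw [Nat.le_zero.1 hk, mul_comm]
    | succ n ih =>
      intro k hk
      have hsq := renewal_sq_le hf hu n ih
      rcases Nat.le_succ_iff.1 hk with hk | rfl
      · refine le_of_mul_le_mul_right ?_ (hpos n)
        calc u (k + 1) * u (n + 1) * u n = u (k + 1) * u n * u (n + 1) := by ring
          _ ≤ u k * u (n + 1) * u (n + 1) := mul_le_mul_of_nonneg_right (ih k hk) (hpos _).le
          _ = u k * u (n + 1) ^ 2 := by ring
          _ ≤ u k * (u n * u (n + 2)) := mul_le_mul_of_nonneg_left hsq (hpos k).le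
          _ = u k * u (n + 1 + 1) * u n := by ring
      · rw [mul_comm]
  exact of_sq_le hpos fun n ↦ renewal_sq_le hf hu n (hle n)

theorem ratio_le {C ℓ : ℝ} (hu : LogConvexSeq u) (hℓ : 0 < ℓ) (hC : ∀ n, u n ≤ C * ℓ ^ n) (n : ℕ) :
    u (n + 1) / u n ≤ ℓ := by
  by_contra! hlt
  set r := u (n + 1) / u n
  have hgeom : ∀ k, u n * r ^ k ≤ u (n + k) := fun k ↦ by
    induction k with
    | zero => simp
    | succ k ih =>
      have hk : r ≤ u (n + k + 1) / u (n + k) := hu.ratio_mono (Nat.le_add_right n k)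
      rw [le_div_iff₀ (hu.pos _)] at hk
      calc u n * r ^ (k + 1) = r * (u n * r ^ k) := by ring
        _ ≤ r * u (n + k) := mul_le_mul_of_nonneg_left ih (hℓ.trans hlt).le
        _ ≤ u (n + (k + 1)) := hk
  obtain ⟨k, hk⟩ := pow_unbounded_of_one_lt (C * ℓ ^ n / u n) ((one_lt_div hℓ).2 hlt)
  rw [div_pow, div_lt_div_iff₀ (hu.pos n) (by positivity)] at hk
  have hbound := (hgeom k).trans (hC (n + k))
  rw [pow_add] at hbound
  linarith

theorem tendsto_ratio {C ℓ : ℝ} (hu : LogConvexSeq u) (hℓ : 0 < ℓ) (hC : ∀ n, u n ≤ C * ℓ ^ n)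
    (hL : ∀ L, 0 < L → L < ℓ → ¬ ∃ C, ∀ n, u n ≤ C * L ^ n) :
    Tendsto (fun n ↦ u (n + 1) / u n) atTop (𝓝 ℓ) := by
  refine tendsto_atTop_isLUB hu.ratio_mono ⟨?_, fun L hL' ↦ ?_⟩
  · rintro _ ⟨n, rfl⟩
    exact hu.ratio_le hℓ hC n
  · by_contra! hlt
    have hratio : ∀ n, u (n + 1) / u n ≤ L := fun n ↦ hL' ⟨n, rfl⟩
    refine hL L ((div_pos (hu.pos 1) (hu.pos 0)).trans_le (hratio 0)) hlt ⟨u 0, fun n ↦ ?_⟩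
    induction n with
    | zero => simp
    | succ n ih =>
      have hn := (div_le_iff₀ (hu.pos n)).1 (hratio n)
      have hLpos : 0 < L := (div_pos (hu.pos 1) (hu.pos 0)).trans_le (hratio 0)
      calc u (n + 1) ≤ L * u n := hn
        _ ≤ L * (u 0 * L ^ n) := by gcongr
        _ = u 0 * L ^ (n + 1) := by ring

end LogConvexSeq

section GrowthRate

open Finset PowerSeries
open PlanarTree

theorem coeff_succ_inv_one_sub_X_mul (f : ℝ⟦X⟧) (n : ℕ) : coeff (n + 1) (1 - X * f)⁻¹ =
    ∑ k ∈ range (n + 1), coeff k f * coeff (n - k) (1 - X * f)⁻¹ := by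
  have hrec : (1 - X * f)⁻¹ = 1 + X * (f * (1 - X * f)⁻¹) := by
    linear_combination PowerSeries.mul_inv_cancel (1 - X * f) (by simp)
  conv_lhs => rw [hrec]
  rw [map_add, coeff_one, if_neg n.succ_ne_zero, zero_add, coeff_succ_X_mul, coeff_mul,
    Finset.Nat.sum_antidiagonal_eq_sum_range_succ (fun i j ↦ coeff i f * coeff j (1 - X * f)⁻¹)]

theorem LogConvexSeq.coeff_inv_one_sub_X_mul {f : ℝ⟦X⟧} (hf : LogConvexSeq fun n ↦ coeff n f) :
    LogConvexSeq fun n ↦ coeff n (1 - X * f)⁻¹ :=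
  hf.renewal (by simp) (coeff_succ_inv_one_sub_X_mul f)

theorem treeSeries_one : treeSeries 1 = C 1 := by
  simp [treeSeries]

theorem coeff_inv_one_sub_X_mul_C (c : ℝ) (n : ℕ) : coeff n (1 - X * C c)⁻¹ = c ^ n := by
  induction n with
  | zero => simp
  | succ n ih => simp [coeff_succ_inv_one_sub_X_mul, coeff_C, ih, pow_succ']

theorem logConvexSeq_coeff_treeSeries (m : ℕ) :
    LogConvexSeq fun n ↦ coeff n (treeSeries (m + 2)) := by
  induction m with
  | zero =>
    have hone : (fun n ↦ coeff n (treeSeries 2)) = fun _ ↦ 1 := by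
      ext n
      rw [treeSeries, treeSeries_one, coeff_inv_one_sub_X_mul_C, one_pow]
    rw [zero_add, hone]
    exact .of_sq_le (fun _ ↦ one_pos) (by simp)
  | succ m ih => exact ih.coeff_inv_one_sub_X_mul

theorem quadratic_nonneg_coeff_inv_one_sub_treeSeries {c : ℝ} (hc : 0 < c) (m n : ℕ) (t : ℝ) :
    0 ≤ t ^ 2 * coeff n (1 - X * (C c * treeSeries m))⁻¹ -
      2 * t * coeff (n + 1) (1 - X * (C c * treeSeries m))⁻¹ +
        coeff (n + 2) (1 - X * (C c * treeSeries m))⁻¹ := by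
  rcases m with _ | _ | m
  · rw [treeSeries, mul_zero, ← map_zero C]
    simp only [coeff_inv_one_sub_X_mul_C, ne_eq, Nat.succ_ne_zero, not_false_eq_true, zero_pow,
      mul_zero, sub_zero, add_zero]
    positivity
  · rw [treeSeries_one, ← map_mul, mul_one]
    simp only [coeff_inv_one_sub_X_mul_C]
    calc 0 ≤ c ^ n * (t - c) ^ 2 := by positivity
      _ = _ := by ring
  · have hf : LogConvexSeq fun n ↦ coeff n (C c * treeSeries (m + 2)) := by
      simpa only [coeff_C_mul] using (logConvexSeq_coeff_treeSeries m).const_mul hc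
    exact hf.coeff_inv_one_sub_X_mul.quadratic_nonneg n t

theorem hasSum_pow_mul_multichoose {κ : ℝ} (hκ : |κ| < 1) (j : ℕ) :
    HasSum (fun K ↦ κ ^ K * ((K + 1).multichoose j : ℝ)) ((1 - κ)⁻¹ ^ (j + 1)) := by
  refine (hasSum_multichoose_mul_pow (j + 1) hκ).congr_fun fun K ↦ ?_
  rw [mul_comm, Nat.multichoose_eq, Nat.multichoose_eq, show K + 1 + j - 1 = K + j by omega,
    show j + 1 + K - 1 = K + j by omega, Nat.choose_symm_add]

theorem hasSum_pow_mul_coeff_treeSeries_pow {κ : ℝ} (hκ : |κ| < 1) (m n : ℕ) :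
    HasSum (fun K ↦ κ ^ K * coeff n (treeSeries (m + 1) ^ (K + 1)))
      ((1 - κ)⁻¹ * coeff n (1 - X * (C (1 - κ)⁻¹ * treeSeries m))⁻¹) := by
  have hsum := hasSum_sum (s := range (n + 1)) fun j _ ↦
    (hasSum_pow_mul_multichoose hκ j).mul_right (coeff (n - j) (treeSeries m ^ j))
  have hval : (1 - κ)⁻¹ * coeff n (1 - X * (C (1 - κ)⁻¹ * treeSeries m))⁻¹ =
      ∑ j ∈ range (n + 1), (1 - κ)⁻¹ ^ (j + 1) * coeff (n - j) (treeSeries m ^ j) := by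
    rw [← pow_one (1 - X * (C (1 - κ)⁻¹ * treeSeries m))⁻¹,
      coeff_inv_one_sub_pow (dvd_mul_right X _), mul_sum]
    refine sum_congr rfl fun j hj ↦ ?_
    rw [Nat.multichoose_one, mul_pow, coeff_X_pow_mul',
      if_pos (Nat.lt_succ_iff.1 (mem_range.1 hj)), mul_pow, ← map_pow, coeff_C_mul]
    ring
  rw [hval]
  refine hsum.congr_fun fun K ↦ ?_
  rw [coeff_treeSeries_succ_pow, mul_sum]
  exact sum_congr rfl fun j _ ↦ by ring

/-- The generating function in the number of roots, `∑ κ ^ K * forestWeight q (K + 1) n`, of the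
forests with `n` edges; it converges for `|κ| < 1 / 2`. -/
noncomputable def forestTransform (q κ : ℝ) (n : ℕ) : ℝ := ∑' K, κ ^ K * forestWeight q (K + 1) n

variable {q κ : ℝ}

theorem pow_mul_forestWeight_le (hq₀ : 0 ≤ q) (hq₁ : q ≤ 1) (hκ₀ : 0 ≤ κ) (K n : ℕ) :
    κ ^ K * forestWeight q (K + 1) n ≤ 2 * 4 ^ n * (2 * κ) ^ K :=
  calc κ ^ K * forestWeight q (K + 1) n ≤ κ ^ K * (2 ^ (K + 1) * 4 ^ n) := by
        gcongr; exact forestWeight_le hq₀ hq₁ _ _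
    _ = 2 * 4 ^ n * (2 * κ) ^ K := by ring

theorem summable_pow_mul_forestWeight (hq₀ : 0 ≤ q) (hq₁ : q ≤ 1) (hκ₀ : 0 ≤ κ) (hκ₁ : κ < 1 / 2)
    (n : ℕ) : Summable fun K ↦ κ ^ K * forestWeight q (K + 1) n :=
  .of_nonneg_of_le (fun K ↦ mul_nonneg (pow_nonneg hκ₀ _) (forestWeight_nonneg hq₀ _ _))
    (fun K ↦ pow_mul_forestWeight_le hq₀ hq₁ hκ₀ K n)
    ((summable_geometric_of_lt_one (by positivity) (by linarith)).mul_left _)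

theorem forestTransform_le (hq₀ : 0 ≤ q) (hq₁ : q ≤ 1) (hκ₀ : 0 ≤ κ) (hκ₁ : κ < 1 / 2) (n : ℕ) :
    forestTransform q κ n ≤ 2 * (1 - 2 * κ)⁻¹ * 4 ^ n := by
  have hgeom := (hasSum_geometric_of_lt_one (by positivity : 0 ≤ 2 * κ) (by linarith)).mul_left
    (2 * (4 : ℝ) ^ n)
  calc forestTransform q κ n ≤ 2 * 4 ^ n * (1 - 2 * κ)⁻¹ :=
        hasSum_le (fun K ↦ pow_mul_forestWeight_le hq₀ hq₁ hκ₀ K n)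
          (summable_pow_mul_forestWeight hq₀ hq₁ hκ₀ hκ₁ n).hasSum hgeom
    _ = 2 * (1 - 2 * κ)⁻¹ * 4 ^ n := by ring

theorem pow_mul_forestWeight_le_forestTransform (hq₀ : 0 ≤ q) (hq₁ : q ≤ 1) (hκ₀ : 0 ≤ κ)
    (hκ₁ : κ < 1 / 2) (K n : ℕ) :
    κ ^ K * forestWeight q (K + 1) n ≤ forestTransform q κ n :=
  (summable_pow_mul_forestWeight hq₀ hq₁ hκ₀ hκ₁ n).le_tsum K fun _ _ ↦
    mul_nonneg (pow_nonneg hκ₀ _) (forestWeight_nonneg hq₀ _ _)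

theorem forestWeight_one_le_forestTransform (hq₀ : 0 ≤ q) (hq₁ : q ≤ 1) (hκ₀ : 0 ≤ κ)
    (hκ₁ : κ < 1 / 2) (n : ℕ) : forestWeight q 1 n ≤ forestTransform q κ n := by
  simpa using pow_mul_forestWeight_le_forestTransform hq₀ hq₁ hκ₀ hκ₁ 0 n

theorem hasSum_comm_of_nonneg {α β : Type*} {F : α → β → ℝ} {r : α → ℝ} {s : β → ℝ} {a : ℝ}
    (hF : ∀ i j, 0 ≤ F i j) (hrow : ∀ i, HasSum (F i) (r i)) (hr : HasSum r a)
    (hcol : ∀ j, HasSum (fun i ↦ F i j) (s j)) : HasSum s a := by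
  have hsummable : Summable (Function.uncurry F) :=
    (summable_prod_of_nonneg fun p ↦ hF p.1 p.2).2
      ⟨fun i ↦ (hrow i).summable, hr.summable.congr fun i ↦ (hrow i).tsum_eq.symm⟩
  rw [hr.unique (hsummable.hasSum.prod_fiberwise hrow)]
  exact ((Equiv.prodComm β α).hasSum_iff.2 hsummable.hasSum).prod_fiberwise hcol

theorem hasSum_forestTransform (hq₀ : 0 ≤ q) (hq₁ : q < 1) (hκ₀ : 0 ≤ κ) (hκ₁ : κ < 1 / 2)
    (n : ℕ) : HasSum (fun m ↦ (1 - q) * q ^ m *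
      ((1 - κ)⁻¹ * coeff n (1 - X * (C (1 - κ)⁻¹ * treeSeries m))⁻¹)) (forestTransform q κ n) := by
  refine hasSum_comm_of_nonneg
    (fun K m ↦ mul_nonneg (pow_nonneg hκ₀ K) (mul_nonneg (mul_nonneg (by linarith)
      (pow_nonneg hq₀ m)) (coeff_treeSeries_pow_nonneg (m + 1) (K + 1) n)))
    (fun K ↦ (hasSum_coeff_treeSeries_pow hq₀ hq₁ (K + 1) n).mul_left (κ ^ K))
    (summable_pow_mul_forestWeight hq₀ hq₁.le hκ₀ hκ₁ n).hasSum fun m ↦ ?_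
  refine ((hasSum_pow_mul_coeff_treeSeries_pow (abs_lt.2 ⟨by linarith, by linarith⟩) m n).mul_left
    ((1 - q) * q ^ m)).congr_fun fun K ↦ ?_
  ring

theorem logConvexSeq_forestTransform (hq₀ : 0 < q) (hq₁ : q < 1) (hκ₀ : 0 ≤ κ) (hκ₁ : κ < 1 / 2) :
    LogConvexSeq (forestTransform q κ) := by
  refine .of_quadratic_nonneg (fun n ↦ (forestWeight_pos hq₀ 0 n).trans_le
    (forestWeight_one_le_forestTransform hq₀.le hq₁.le hκ₀ hκ₁ n)) fun n t ↦ ?_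
  have hsum := fun n ↦ hasSum_forestTransform hq₀.le hq₁ hκ₀ hκ₁ n
  have hc : 0 < (1 - κ)⁻¹ := inv_pos.2 (by linarith)
  refine ((((hsum n).mul_left (t ^ 2)).sub ((hsum (n + 1)).mul_left (2 * t))).add
    (hsum (n + 2))).nonneg fun m ↦ ?_
  have hm := mul_nonneg (mul_nonneg (mul_nonneg (by linarith : 0 ≤ 1 - q) (pow_nonneg hq₀.le m))
    hc.le) (quadratic_nonneg_coeff_inv_one_sub_treeSeries hc m n t)
  calc 0 ≤ _ := hm
    _ = _ := by ring

theorem not_forall_eq_one_add_mul {g : ℝ} (hg : 1 / 4 < g) {x : ℕ → ℝ} (hx : ∀ m, 0 ≤ x m) :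
    ¬ ∀ m, x (m + 1) = 1 + g * (x m * x (m + 1)) := by
  intro hrec
  have hlt : ∀ m, g * x m < 1 := fun m ↦ by
    by_contra! hge
    nlinarith [hrec m, mul_le_mul_of_nonneg_right hge (hx (m + 1))]
  -- The map `x ↦ (1 - g * x)⁻¹` has no fixed point because `1 - x + g * x ^ 2` stays away from `0`.
  have hδ : 0 < 1 - 1 / (4 * g) := by
    rw [sub_pos, div_lt_one (by linarith)]; linarith
  have hincr : ∀ m, x m + (1 - 1 / (4 * g)) ≤ x (m + 1) := fun m ↦ by
    have hsq : 1 - 1 / (4 * g) ≤ 1 - x m + g * x m ^ 2 := by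
      have h : 1 - x m + g * x m ^ 2 - (1 - 1 / (4 * g)) = g * (x m - 1 / (2 * g)) ^ 2 := by
        field_simp; ring
      nlinarith [mul_nonneg (by linarith : 0 ≤ g) (sq_nonneg (x m - 1 / (2 * g)))]
    have hmul : (x (m + 1) - x m) * (1 - g * x m) = 1 - x m + g * x m ^ 2 := by
      linear_combination hrec m
    have hdiff : 0 ≤ x (m + 1) - x m :=
      nonneg_of_mul_nonneg_left (by linarith) (sub_pos.2 (hlt m))
    nlinarith [mul_nonneg hdiff (mul_nonneg (by linarith : 0 ≤ g) (hx m))]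
  have hlin : ∀ m : ℕ, m * (1 - 1 / (4 * g)) ≤ x m := fun m ↦ by
    induction m with
    | zero => simpa using hx 0
    | succ m ih => push_cast; linarith [hincr m]
  obtain ⟨m, hm⟩ := exists_nat_gt (4 / (1 - 1 / (4 * g)))
  rw [div_lt_iff₀ hδ] at hm
  nlinarith [hlt m, hlin m]

theorem not_forall_exists_coeff_treeSeries_le {L : ℝ} (hL₀ : 0 < L) (hL₁ : L < 4) :
    ¬ ∀ m, ∃ C, ∀ n, coeff n (treeSeries m) ≤ C * L ^ n := by
  intro hbound
  obtain ⟨g, hg₁, hg₂⟩ : ∃ g, 1 / 4 < g ∧ g < 1 / L :=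
    exists_between (one_div_lt_one_div_of_lt hL₀ hL₁)
  have hg₀ : 0 < g := by linarith
  have hnonneg : ∀ m n, 0 ≤ coeff n (treeSeries m) * g ^ n := fun m n ↦
    mul_nonneg (by simpa using coeff_treeSeries_pow_nonneg m 1 n) (by positivity)
  have hsummable : ∀ m, Summable fun n ↦ coeff n (treeSeries m) * g ^ n := fun m ↦ by
    obtain ⟨C, hC⟩ := hbound m
    refine .of_nonneg_of_le (hnonneg m) (fun n ↦ ?_) ((summable_geometric_of_lt_one
      (by positivity : 0 ≤ L * g) (by rwa [lt_div_iff₀' hL₀] at hg₂)).mul_left C)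
    rw [mul_pow, ← mul_assoc]
    exact mul_le_mul_of_nonneg_right (hC n) (by positivity)
  set x : ℕ → ℝ := fun m ↦ ∑' n, coeff n (treeSeries m) * g ^ n with hx
  refine not_forall_eq_one_add_mul hg₁ (x := x) (fun m ↦ tsum_nonneg (hnonneg m)) fun m ↦ ?_
  have hprod := tsum_mul_tsum_eq_tsum_sum_antidiagonal_of_summable_norm
    (hsummable m).norm (hsummable (m + 1)).norm
  simp only [hx]
  rw [hprod, (hsummable (m + 1)).tsum_eq_zero_add, ← tsum_mul_left]
  congr 1
  · simp [treeSeries]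
  · refine tsum_congr fun n ↦ ?_
    rw [treeSeries, coeff_succ_inv_one_sub_X_mul, sum_mul, mul_sum,
      Finset.Nat.sum_antidiagonal_eq_sum_range_succ_mk]
    refine sum_congr rfl fun k hk ↦ ?_
    rw [← Nat.add_sub_of_le (Nat.lt_succ_iff.1 (mem_range.1 hk))]
    simp only [Nat.add_sub_cancel_left]
    ring

theorem tendsto_forestTransform_ratio (hq₀ : 0 < q) (hq₁ : q < 1) (hκ₀ : 0 ≤ κ) (hκ₁ : κ < 1 / 2) :
    Tendsto (fun n ↦ forestTransform q κ (n + 1) / forestTransform q κ n) atTop (𝓝 4) := by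
  refine (logConvexSeq_forestTransform hq₀ hq₁ hκ₀ hκ₁).tendsto_ratio (by norm_num)
    (forestTransform_le hq₀.le hq₁.le hκ₀ hκ₁) fun L hL₀ hL₁ hC ↦ ?_
  obtain ⟨C, hC⟩ := hC
  refine not_forall_exists_coeff_treeSeries_le hL₀ hL₁ fun m ↦ ?_
  rcases m with _ | m
  · exact ⟨1, fun n ↦ by simpa [treeSeries] using (pow_pos hL₀ n).le⟩
  have hm : 0 < (1 - q) * q ^ m := mul_pos (by linarith) (pow_pos hq₀ m)
  refine ⟨((1 - q) * q ^ m)⁻¹ * C, fun n ↦ ?_⟩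
  rw [mul_assoc, ← div_eq_inv_mul, le_div_iff₀' hm]
  calc (1 - q) * q ^ m * coeff n (treeSeries (m + 1))
      ≤ forestWeight q 1 n := by
        have hsum := hasSum_coeff_treeSeries_pow hq₀.le hq₁ 1 n
        rw [← hsum.tsum_eq]
        simpa using hsum.summable.le_tsum m fun i _ ↦ mul_nonneg (mul_nonneg (by linarith)
          (pow_nonneg hq₀.le _)) (coeff_treeSeries_pow_nonneg _ _ _)
    _ ≤ forestTransform q κ n := forestWeight_one_le_forestTransform hq₀.le hq₁.le hκ₀ hκ₁ n
    _ ≤ C * L ^ n := hC n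

end GrowthRate

section Compactness

open Finset PlanarTree

variable {q κ : ℝ}

theorem forestTransform_succ (hκ₀ : 0 ≤ κ) (hκ₁ : κ < 1) (n : ℕ) :
    forestTransform q κ (n + 1) =
      q * ∑ j ∈ range (n + 1), (1 - κ)⁻¹ ^ (j + 2) * forestWeight q (j + 1) (n - j) := by
  have hsum := (hasSum_sum (s := range (n + 1)) fun j _ ↦
    (hasSum_pow_mul_multichoose (κ := κ) (abs_lt.2 ⟨by linarith, hκ₁⟩) (j + 1)).mul_right
      (forestWeight q (j + 1) (n - j))).mul_left q
  refine HasSum.tsum_eq (hsum.congr_fun fun K ↦ ?_)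
  rw [forestWeight_succ, mul_left_comm, mul_sum]
  exact congrArg _ (sum_congr rfl fun j _ ↦ by ring)

theorem forestTransform_zero_left (q : ℝ) : forestTransform q 0 = forestWeight q 1 := by
  funext n
  refine (tsum_eq_single 0 fun K hK ↦ ?_).trans (by simp)
  rw [zero_pow hK, zero_mul]

theorem forestWeight_one_succ_le (hq₀ : 0 < q) (hq₁ : q < 1) (n : ℕ) :
    forestWeight q 1 (n + 1) ≤ 4 * forestWeight q 1 n := by
  have h := (logConvexSeq_forestTransform hq₀ hq₁ le_rfl (by norm_num)).ratio_le (by norm_num)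
    (forestTransform_le hq₀.le hq₁.le le_rfl (by norm_num)) n
  rwa [forestTransform_zero_left, div_le_iff₀ (forestWeight_pos hq₀ 0 n)] at h

theorem tendsto_forestWeight_one_ratio (hq₀ : 0 < q) (hq₁ : q < 1) :
    Tendsto (fun n ↦ forestWeight q 1 (n + 1) / forestWeight q 1 n) atTop (𝓝 4) := by
  simpa only [forestTransform_zero_left] using
    tendsto_forestTransform_ratio hq₀ hq₁ le_rfl (by norm_num : (0 : ℝ) < 1 / 2)

theorem forestWeight_one_add_le (hq₀ : 0 < q) (hq₁ : q < 1) (n k : ℕ) :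
    forestWeight q 1 (n + k) ≤ 4 ^ k * forestWeight q 1 n := by
  induction k with
  | zero => simp
  | succ k ih =>
    calc forestWeight q 1 (n + (k + 1)) ≤ 4 * forestWeight q 1 (n + k) :=
          forestWeight_one_succ_le hq₀ hq₁ _
      _ ≤ 4 * (4 ^ k * forestWeight q 1 n) := by gcongr
      _ = 4 ^ (k + 1) * forestWeight q 1 n := by ring

/-- The weight of the forests with `K + 1` roots and `n` edges, relative to that of the trees. -/
noncomputable def forestRatio (q : ℝ) (n K : ℕ) : ℝ := forestWeight q (K + 1) n / forestWeight q 1 n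

theorem forestRatio_nonneg (hq : 0 ≤ q) (n K : ℕ) : 0 ≤ forestRatio q n K :=
  div_nonneg (forestWeight_nonneg hq _ _) (forestWeight_nonneg hq _ _)

theorem forestRatio_le (hq₀ : 0 < q) (hq₁ : q < 1) (n K : ℕ) :
    forestRatio q n K ≤ 4 / q * 4 ^ K := by
  rw [forestRatio, div_le_iff₀ (forestWeight_pos hq₀ 0 n), div_mul_eq_mul_div, div_mul_eq_mul_div,
    le_div_iff₀' hq₀, ← pow_succ']
  refine le_trans ?_ (forestWeight_one_add_le hq₀ hq₁ n (K + 1))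
  rw [← add_assoc, forestWeight_succ]
  gcongr
  have hterm := single_le_sum (f := fun j ↦
      (Nat.multichoose 1 (j + 1) : ℝ) * forestWeight q (j + 1) (n + K - j))
    (fun j _ ↦ mul_nonneg (Nat.cast_nonneg _) (forestWeight_nonneg hq₀.le _ _))
    (mem_range.2 (by omega : K < n + K + 1))
  simpa using hterm

theorem hasSum_pow_mul_forestRatio (hq₀ : 0 ≤ q) (hq₁ : q ≤ 1) (hκ₀ : 0 ≤ κ) (hκ₁ : κ < 1 / 2)
    (n : ℕ) : HasSum (fun K ↦ κ ^ K * forestRatio q n K)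
      (forestTransform q κ n / forestWeight q 1 n) := by
  have h := (summable_pow_mul_forestWeight hq₀ hq₁ hκ₀ hκ₁ n).hasSum.div_const (forestWeight q 1 n)
  exact h.congr_fun fun K ↦ by rw [forestRatio, mul_div_assoc]

theorem forestTransform_div_le (hq₀ : 0 < q) (hq₁ : q < 1) (hκ₀ : 0 ≤ κ) (hκ₁ : κ ≤ 1 / 8) (n : ℕ) :
    forestTransform q κ n / forestWeight q 1 n ≤ 8 / q := by
  have hgeom := (hasSum_geometric_of_lt_one (by norm_num : (0 : ℝ) ≤ 1 / 2) (by norm_num)).mul_left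
    (4 / q)
  calc forestTransform q κ n / forestWeight q 1 n ≤ 4 / q * (1 - 1 / 2)⁻¹ := by
        refine hasSum_le (fun K ↦ ?_)
          (hasSum_pow_mul_forestRatio hq₀.le hq₁.le hκ₀ (by linarith) n) hgeom
        calc κ ^ K * forestRatio q n K ≤ (1 / 8) ^ K * (4 / q * 4 ^ K) := by
              gcongr; exacts [forestRatio_nonneg hq₀.le _ _, forestRatio_le hq₀ hq₁ n K]
          _ = 4 / q * (1 / 2) ^ K := by
              rw [mul_left_comm, ← mul_pow]; norm_num
    _ = 8 / q := by ring

theorem forestWeight_sub_le (hq₀ : 0 < q) (hq₁ : q < 1) {n j : ℕ} (hj : j < n) :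
    forestWeight q (j + 1) (n - (j + 1)) ≤ 8 / q ^ 2 * (7 / 8) ^ j * forestWeight q 1 n := by
  obtain ⟨n, rfl⟩ := Nat.exists_eq_add_one_of_ne_zero (Nat.ne_zero_of_lt hj)
  rw [Nat.add_sub_add_right]
  have hterm := single_le_sum (f := fun i ↦
      ((1 : ℝ) - 1 / 8)⁻¹ ^ (i + 2) * forestWeight q (i + 1) (n - i))
    (fun i _ ↦ mul_nonneg (by norm_num) (forestWeight_nonneg hq₀.le _ _))
    (mem_range.2 hj)
  have hdiv := forestTransform_div_le hq₀ hq₁ (by norm_num) le_rfl (n + 1)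
  rw [div_le_iff₀ (forestWeight_pos hq₀ 0 _), forestTransform_succ (by norm_num) (by norm_num),
    ← le_div_iff₀' hq₀] at hdiv
  calc forestWeight q (j + 1) (n - j)
      = (7 / 8) ^ (j + 2) *
          (((1 : ℝ) - 1 / 8)⁻¹ ^ (j + 2) * forestWeight q (j + 1) (n - j)) := by
        rw [← mul_assoc, ← mul_pow]; norm_num
    _ ≤ (7 / 8) ^ j * (8 / q * forestWeight q 1 (n + 1) / q) := by
        gcongr ?_ * ?_
        · exact mul_nonneg (by norm_num) (forestWeight_nonneg hq₀.le _ _)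
        · exact pow_le_pow_of_le_one (by norm_num) (by norm_num) (by omega)
        · exact hterm.trans hdiv
    _ = 8 / q ^ 2 * (7 / 8) ^ j * forestWeight q 1 (n + 1) := by ring

theorem norm_pow_mul_le {d : ℕ → ℝ} {C b : ℝ} (hd : ∀ K, |d K| ≤ C * b ^ K) (hκ : 0 ≤ κ) (K : ℕ) :
    ‖κ ^ K * d K‖ ≤ C * (κ * b) ^ K :=
  calc ‖κ ^ K * d K‖ = κ ^ K * |d K| := by
        rw [Real.norm_eq_abs, abs_mul, abs_of_nonneg (pow_nonneg hκ K)]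
    _ ≤ κ ^ K * (C * b ^ K) := by gcongr; exact hd K
    _ = C * (κ * b) ^ K := by rw [mul_pow]; ring

theorem tsum_pow_mul_eq_add {d : ℕ → ℝ} {C b : ℝ} (hb : 0 ≤ b) (hd : ∀ K, |d K| ≤ C * b ^ K)
    (hκ₀ : 0 ≤ κ) (hκ : κ * b < 1) :
    ∑' K, κ ^ K * d K = d 0 + κ * ∑' K, κ ^ K * d (K + 1) := by
  have hsum : Summable fun K ↦ κ ^ K * d K := .of_norm_bounded
    ((summable_geometric_of_lt_one (mul_nonneg hκ₀ hb) hκ).mul_left C) (norm_pow_mul_le hd hκ₀)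
  rw [hsum.tsum_eq_zero_add, ← tsum_mul_left, pow_zero, one_mul]
  exact congrArg _ (tsum_congr fun K ↦ by ring)

theorem abs_tsum_pow_mul_le {d : ℕ → ℝ} {C b : ℝ} (hb : 0 ≤ b) (hd : ∀ K, |d K| ≤ C * b ^ K)
    (hκ₀ : 0 ≤ κ) (hκ : κ * b < 1) : |∑' K, κ ^ K * d K| ≤ C * (1 - κ * b)⁻¹ :=
  tsum_of_norm_bounded ((hasSum_geometric_of_lt_one (mul_nonneg hκ₀ hb) hκ).mul_left C)
    (norm_pow_mul_le hd hκ₀)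

theorem eventually_mul_lt_nhdsGT_zero (c : ℝ) {ε : ℝ} (hε : 0 < ε) :
    ∀ᶠ κ in 𝓝[>] (0 : ℝ), κ * c < ε :=
  (tendsto_nhdsWithin_of_tendsto_nhds
    (by simpa using (continuous_mul_const c).tendsto (0 : ℝ))).eventually_lt_const hε

theorem tendsto_zero_apply_zero_of_tsum_pow_mul {ι : Type*} {l : Filter ι} {d : ι → ℕ → ℝ}
    {C b : ℝ} (hb : 0 ≤ b) (hd : ∀ i K, |d i K| ≤ C * b ^ K)
    (h : ∀ᶠ κ in 𝓝[>] (0 : ℝ), Tendsto (fun i ↦ ∑' K, κ ^ K * d i K) l (𝓝 0)) :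
    Tendsto (fun i ↦ d i 0) l (𝓝 0) := by
  refine Metric.tendsto_nhds.2 fun ε hε ↦ ?_
  obtain ⟨κ, hκ, hκb, hκC, hκ₀⟩ := (h.and <| (eventually_mul_lt_nhdsGT_zero b one_half_pos).and <|
    (eventually_mul_lt_nhdsGT_zero (C * b * 2) (half_pos hε)).and self_mem_nhdsWithin).exists
  filter_upwards [Metric.tendsto_nhds.1 hκ _ (half_pos hε)] with i hi
  replace hκ₀ : 0 < κ := hκ₀
  have hC : 0 ≤ C := by simpa using (abs_nonneg _).trans (hd i 0)
  have htail : |∑' K, κ ^ K * d i (K + 1)| ≤ C * b * 2 := by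
    refine (abs_tsum_pow_mul_le (C := C * b) hb (fun K ↦ (hd i (K + 1)).trans_eq (by ring))
      hκ₀.le (by linarith)).trans ?_
    gcongr
    exact inv_le_of_inv_le₀ two_pos (by linarith)
  rw [tsum_pow_mul_eq_add hb (hd i) hκ₀.le (by linarith), Real.dist_0_eq_abs] at hi
  rw [Real.dist_0_eq_abs]
  calc |d i 0| ≤ |d i 0 + κ * ∑' K, κ ^ K * d i (K + 1)| + |κ * ∑' K, κ ^ K * d i (K + 1)| := by
        simpa using abs_sub (d i 0 + κ * ∑' K, κ ^ K * d i (K + 1))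
          (κ * ∑' K, κ ^ K * d i (K + 1))
    _ ≤ |d i 0 + κ * ∑' K, κ ^ K * d i (K + 1)| + κ * (C * b * 2) := by
        rw [abs_mul κ, abs_of_pos hκ₀]; gcongr
    _ < ε := by linarith

theorem tendsto_zero_of_tendsto_tsum_pow_mul {ι : Type*} {l : Filter ι} {d : ι → ℕ → ℝ} {C b : ℝ}
    (hb : 0 ≤ b) (hd : ∀ i K, |d i K| ≤ C * b ^ K)
    (h : ∀ᶠ κ in 𝓝[>] (0 : ℝ), Tendsto (fun i ↦ ∑' K, κ ^ K * d i K) l (𝓝 0)) (K : ℕ) :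
    Tendsto (fun i ↦ d i K) l (𝓝 0) := by
  have hzero := tendsto_zero_apply_zero_of_tsum_pow_mul hb hd h
  induction K generalizing d C with
  | zero => exact hzero
  | succ _ ih =>
    have hd' i k : |d i (k + 1)| ≤ C * b * b ^ k := (hd i (k + 1)).trans_eq (by ring)
    have h' : ∀ᶠ κ in 𝓝[>] (0 : ℝ), Tendsto (fun i ↦ ∑' K, κ ^ K * d i (K + 1)) l (𝓝 0) := by
      filter_upwards [h, eventually_mul_lt_nhdsGT_zero b one_pos, self_mem_nhdsWithin]
        with κ hκ hκb hκ₀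
      replace hκ₀ : 0 < κ := hκ₀
      have htail := (hκ.sub hzero).const_mul κ⁻¹
      rw [sub_zero, mul_zero] at htail
      refine htail.congr fun i ↦ ?_
      rw [tsum_pow_mul_eq_add hb (hd i) hκ₀.le hκb, add_sub_cancel_left,
        inv_mul_cancel_left₀ hκ₀.ne']
    exact ih hd' h' (tendsto_zero_apply_zero_of_tsum_pow_mul hb hd' h')

theorem tendsto_forestRatio_succ_sub (hq₀ : 0 < q) (hq₁ : q < 1) (K : ℕ) :
    Tendsto (fun n ↦ forestRatio q (n + 1) K - forestRatio q n K) atTop (𝓝 0) := by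
  refine tendsto_zero_of_tendsto_tsum_pow_mul (C := 4 / q) (b := 4)
    (d := fun n K ↦ forestRatio q (n + 1) K - forestRatio q n K) (by norm_num) (fun n K ↦ ?_) ?_ K
  · exact abs_sub_le_of_nonneg_of_le (forestRatio_nonneg hq₀.le _ _) (forestRatio_le hq₀ hq₁ _ _)
      (forestRatio_nonneg hq₀.le _ _) (forestRatio_le hq₀ hq₁ _ _)
  filter_upwards [Ioo_mem_nhdsGT (by norm_num : (0 : ℝ) < 1 / 8)] with κ hκ
  have hκ₁ : κ < 1 / 2 := hκ.2.trans (by norm_num)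
  set U := forestTransform q κ
  set W := forestWeight q 1
  have hW (n) : 0 < W n := forestWeight_pos hq₀ 0 n
  have hU (n) : 0 < U n :=
    (hW n).trans_le (forestWeight_one_le_forestTransform hq₀.le hq₁.le hκ.1.le hκ₁ n)
  have hratio : Tendsto (fun n ↦ U (n + 1) / U n / (W (n + 1) / W n) - 1) atTop (𝓝 0) := by
    have h := ((tendsto_forestTransform_ratio hq₀ hq₁ hκ.1.le hκ₁).div
      (tendsto_forestWeight_one_ratio hq₀ hq₁) (by norm_num)).sub_const 1
    rwa [div_self (by norm_num), sub_self] at h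
  have hbdd : IsBoundedUnder (· ≤ ·) atTop (norm ∘ fun n ↦ U n / W n) :=
    isBoundedUnder_of ⟨8 / q, fun n ↦ by
      rw [Function.comp_apply, Real.norm_of_nonneg (div_nonneg (hU n).le (hW n).le)]
      exact forestTransform_div_le hq₀ hq₁ hκ.1.le hκ.2.le n⟩
  refine (hratio.zero_mul_isBoundedUnder_le hbdd).congr fun n ↦ ?_
  have hdiff := (hasSum_pow_mul_forestRatio hq₀.le hq₁.le hκ.1.le hκ₁ (n + 1)).sub
    (hasSum_pow_mul_forestRatio hq₀.le hq₁.le hκ.1.le hκ₁ n)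
  simp only [← mul_sub] at hdiff
  calc (U (n + 1) / U n / (W (n + 1) / W n) - 1) * (U n / W n)
      = U (n + 1) / W (n + 1) - U n / W n := by
        field_simp [(hU n).ne', (hW n).ne', (hW (n + 1)).ne']
    _ = _ := hdiff.tsum_eq.symm

end Compactness

section Harmonic

open Finset PlanarTree

variable {q : ℝ} {c : ℕ → ℝ}

/-- The limits of `forestRatio q n` as `n → ∞`: normalised nonnegative eigenvectors of the transfer
operator that replaces the `K + 1` vertices of a level by the `j + 1` vertices of the next one. -/
structure IsHarmonic (q : ℝ) (c : ℕ → ℝ) : Prop where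
  nonneg : ∀ K, 0 ≤ c K
  apply_zero : c 0 = 1
  hasSum : ∀ K, HasSum (fun j ↦ ((K + 1).multichoose (j + 1) : ℝ) * (c j / 4 ^ (j + 1))) (q⁻¹ * c K)

theorem tendsto_forestRatio_add_sub (hq₀ : 0 < q) (hq₁ : q < 1) (k K : ℕ) :
    Tendsto (fun n ↦ forestRatio q (n + k) K - forestRatio q n K) atTop (𝓝 0) := by
  induction k with
  | zero => simp
  | succ k ih =>
    have h := ((tendsto_add_atTop_iff_nat k).2 (tendsto_forestRatio_succ_sub hq₀ hq₁ K)).add ih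
    rw [add_zero] at h
    exact h.congr fun n ↦ by rw [sub_add_sub_cancel, add_assoc]

theorem tendsto_forestWeight_one_div_add (hq₀ : 0 < q) (hq₁ : q < 1) (k : ℕ) :
    Tendsto (fun n ↦ forestWeight q 1 n / forestWeight q 1 (n + k)) atTop (𝓝 (1 / 4 ^ k)) := by
  induction k with
  | zero =>
    refine tendsto_const_nhds.congr fun n ↦ ?_
    rw [pow_zero, div_one, add_zero, div_self (forestWeight_pos hq₀ 0 n).ne']
  | succ k ih =>
    have h := ih.div ((tendsto_add_atTop_iff_nat k).2 (tendsto_forestWeight_one_ratio hq₀ hq₁))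
      (by norm_num)
    rw [div_div, ← pow_succ] at h
    refine h.congr fun n ↦ ?_
    have hk := (forestWeight_pos hq₀ 0 (n + k)).ne'
    rw [Pi.div_apply, add_assoc, div_div, mul_div_cancel₀ _ hk]

theorem tendsto_forestWeight_sub_div {l : Filter ℕ} (hl : l ≤ atTop) (hq₀ : 0 < q) (hq₁ : q < 1)
    {K : ℕ} {a : ℝ} (ha : Tendsto (fun n ↦ forestRatio q n K) l (𝓝 a)) (k : ℕ) :
    Tendsto (fun n ↦ forestWeight q (K + 1) (n - k) / forestWeight q 1 n) l (𝓝 (a / 4 ^ k)) := by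
  have hsub := tendsto_sub_atTop_nat k
  have hshift := ha.sub (((tendsto_forestRatio_add_sub hq₀ hq₁ k K).comp hsub).mono_left hl)
  have hprod := hshift.mul (((tendsto_forestWeight_one_div_add hq₀ hq₁ k).comp hsub).mono_left hl)
  rw [sub_zero, mul_one_div] at hprod
  refine hprod.congr' ?_
  filter_upwards [hl (eventually_ge_atTop k)] with n hn
  simp only [Function.comp_apply, Nat.sub_add_cancel hn, sub_sub_cancel]
  rw [forestRatio, div_mul_div_cancel₀ (forestWeight_pos hq₀ 0 _).ne']

theorem inv_mul_forestRatio (hq : q ≠ 0) {n : ℕ} (hn : n ≠ 0) (K : ℕ) : q⁻¹ * forestRatio q n K =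
    ∑ j ∈ range n, ((K + 1).multichoose (j + 1) : ℝ) *
      (forestWeight q (j + 1) (n - (j + 1)) / forestWeight q 1 n) := by
  obtain ⟨n, rfl⟩ := Nat.exists_eq_add_one_of_ne_zero hn
  rw [forestRatio, forestWeight_succ q (K + 1), mul_div_assoc, inv_mul_cancel_left₀ hq, sum_div]
  exact sum_congr rfl fun j _ ↦ by rw [mul_div_assoc, Nat.add_sub_add_right]

theorem hasSum_of_tendsto_tsum_of_dominated {ι β : Type*} {l : Filter ι} [l.NeBot]
    {F : ι → β → ℝ} {B g : β → ℝ} {a : ℝ} (hB : Summable B) (hF₀ : ∀ i j, 0 ≤ F i j)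
    (hFB : ∀ i j, F i j ≤ B j) (hlim : ∀ j, Tendsto (F · j) l (𝓝 (g j)))
    (hsum : Tendsto (fun i ↦ ∑' j, F i j) l (𝓝 a)) : HasSum g a := by
  have hdom := tendsto_tsum_of_dominated_convergence hB hlim
    (.of_forall fun i j ↦ by rw [Real.norm_of_nonneg (hF₀ i j)]; exact hFB i j)
  rw [tendsto_nhds_unique hsum hdom]
  exact (Summable.of_nonneg_of_le (fun j ↦ ge_of_tendsto' (hlim j) fun i ↦ hF₀ i j)
    (fun j ↦ le_of_tendsto' (hlim j) fun i ↦ hFB i j) hB).hasSum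

theorem isHarmonic_of_tendsto {l : Filter ℕ} [l.NeBot] (hl : l ≤ atTop) (hq₀ : 0 < q) (hq₁ : q < 1)
    (hc : ∀ K, Tendsto (fun n ↦ forestRatio q n K) l (𝓝 (c K))) : IsHarmonic q c where
  nonneg K := ge_of_tendsto' (hc K) fun n ↦ forestRatio_nonneg hq₀.le n K
  apply_zero := tendsto_nhds_unique (hc 0) <| tendsto_const_nhds.congr fun n ↦
    (div_self (forestWeight_pos hq₀ 0 n).ne').symm
  hasSum K := by
    let F (n j : ℕ) : ℝ := if j < n then ((K + 1).multichoose (j + 1) : ℝ) *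
      (forestWeight q (j + 1) (n - (j + 1)) / forestWeight q 1 n) else 0
    let B (j : ℕ) : ℝ := 8 / q ^ 2 * (7 / 8) ^ j * (K + 1).multichoose (j + 1)
    have hF₀ (n j) : 0 ≤ F n j := by
      have hW := forestWeight_nonneg hq₀.le
      dsimp only [F]
      split_ifs
      exacts [mul_nonneg (Nat.cast_nonneg _) (div_nonneg (hW _ _) (hW _ _)), le_rfl]
    have hFB (n j) : F n j ≤ B j := by
      dsimp only [F, B]
      split_ifs with hj
      · rw [mul_comm (_ * _)]
        gcongr
        exact (div_le_iff₀ (forestWeight_pos hq₀ 0 n)).2 (forestWeight_sub_le hq₀ hq₁ hj)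
      · positivity
    have hB : Summable B := by
      have h := (hasSum_multichoose_mul_pow (K + 1) (x := 7 / 8) (by norm_num)).summable
      refine (((summable_nat_add_iff 1).2 h).mul_left (64 / (7 * q ^ 2))).congr fun j ↦ ?_
      ring
    refine hasSum_of_tendsto_tsum_of_dominated (l := l) hB hF₀ hFB (fun j ↦ ?_) ?_
    · refine ((tendsto_forestWeight_sub_div hl hq₀ hq₁ (hc j) (j + 1)).const_mul _).congr' ?_
      filter_upwards [hl (eventually_gt_atTop j)] with n hn
      exact (if_pos hn).symm
    · refine ((hc K).const_mul q⁻¹).congr' ?_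
      filter_upwards [hl (eventually_gt_atTop 0)] with n hn
      rw [inv_mul_forestRatio hq₀.ne' hn.ne',
        tsum_eq_sum fun j hj ↦ if_neg (mem_range.not.1 hj)]
      exact sum_congr rfl fun j hj ↦ (if_pos (mem_range.1 hj)).symm

end Harmonic

section HarmonicUnique

open Real

variable {μ : ℝ} {c : ℕ → ℝ}

/-- The coordinate on `[0, 1/2)` in which the map `κ ↦ 1 / (4 * (1 - κ))` becomes the translation
`y ↦ y + 1`. -/
noncomputable def abelPoint (y : ℝ) : ℝ := y / (2 * (1 + y))

/-- The generating function of `c` in the coordinate `abelPoint`. -/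
noncomputable def abelTransform (c : ℕ → ℝ) (y : ℝ) : ℝ := ∑' K, abelPoint y ^ K * c K

variable {x y z : ℝ}

theorem abelPoint_nonneg (hy : 0 ≤ y) : 0 ≤ abelPoint y := by
  unfold abelPoint; positivity

theorem abelPoint_lt_half (hy : 0 ≤ y) : abelPoint y < 1 / 2 := by
  rw [abelPoint, div_lt_div_iff₀ (by positivity) two_pos]; linarith

theorem abelPoint_le_abelPoint (hx : 0 ≤ x) (hxy : x ≤ y) : abelPoint x ≤ abelPoint y := by
  rw [abelPoint, abelPoint, div_le_div_iff₀ (by positivity) (by linarith)]; linarith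

theorem inv_abelPoint (hy : 0 < y) : (abelPoint y)⁻¹ = 2 + 2 / y := by
  rw [abelPoint, inv_div]; field_simp; ring

theorem abelPoint_pos (hy : 0 < y) : 0 < abelPoint y := by
  unfold abelPoint; positivity

theorem one_sub_abelPoint (hy : 0 ≤ y) : 1 - abelPoint y = (2 + y) / (1 + y) / 2 := by
  unfold abelPoint; field_simp; ring

theorem abelPoint_add_one (hy : 0 ≤ y) : abelPoint (y + 1) = (1 - abelPoint y)⁻¹ / 4 := by
  rw [one_sub_abelPoint hy, abelPoint]
  field_simp
  ring

theorem abelPoint_le_rpow_mul_rpow (hx : 0 < x) (hy : 0 < y) (hz : 0 < z) {a : ℝ} (ha₀ : 0 ≤ a)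
    (ha₁ : a ≤ 1) (hinv : z⁻¹ = (1 - a) * x⁻¹ + a * y⁻¹) :
    abelPoint z ≤ abelPoint x ^ (1 - a) * abelPoint y ^ a := by
  have hx' := abelPoint_pos hx
  have hy' := abelPoint_pos hy
  have hmean := geom_mean_le_arith_mean2_weighted (sub_nonneg.2 ha₁) ha₀ (inv_pos.2 hx').le
    (inv_pos.2 hy').le (sub_add_cancel 1 a)
  have hz' : (abelPoint z)⁻¹ = (1 - a) * (abelPoint x)⁻¹ + a * (abelPoint y)⁻¹ := by
    simp only [inv_abelPoint, hx, hy, hz, div_eq_mul_inv, hinv]; ring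
  rwa [← hz', inv_rpow hx'.le, inv_rpow hy'.le, ← mul_inv,
    inv_le_inv₀ (by positivity) (abelPoint_pos hz)] at hmean

namespace IsHarmonic

theorem hasSum_abelPoint_add_one (h : IsHarmonic (exp (-μ)) c) (hy : 0 ≤ y) {s : ℝ}
    (hs : HasSum (fun K ↦ abelPoint y ^ K * c K) s) :
    HasSum (fun K ↦ abelPoint (y + 1) ^ K * c K) (((2 + y) / (1 + y)) ^ 2 * exp μ * s) := by
  have hκ₀ := abelPoint_nonneg hy
  have hκ₁ := abelPoint_lt_half hy
  have hcol (j : ℕ) := (hasSum_pow_mul_multichoose (κ := abelPoint y)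
    (abs_lt.2 ⟨by linarith, by linarith⟩) (j + 1)).mul_right (c j / 4 ^ (j + 1))
  have hrow (K : ℕ) := (h.hasSum K).mul_left (abelPoint y ^ K)
  have hcomm := hasSum_comm_of_nonneg
    (fun K j ↦ mul_nonneg (pow_nonneg hκ₀ K) (mul_nonneg (Nat.cast_nonneg _)
      (div_nonneg (h.nonneg j) (by positivity)))) hrow
    ((hs.mul_left (exp μ)).congr_fun fun K ↦ by rw [← exp_neg, neg_neg]; ring)
    fun j ↦ (hcol j).congr_fun fun K ↦ (mul_assoc _ _ _).symm
  have hne : 1 - abelPoint y ≠ 0 := by linarith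
  have hscaled := hcomm.mul_left (((2 + y) / (1 + y)) ^ 2)
  rw [← mul_assoc] at hscaled
  refine hscaled.congr_fun fun j ↦ ?_
  rw [abelPoint_add_one hy, ← (mul_div_cancel₀ ((2 + y) / (1 + y)) two_ne_zero),
    ← one_sub_abelPoint hy]
  simp only [div_pow, inv_pow, pow_succ]
  field_simp
  ring

theorem summable_abelPoint_natCast (h : IsHarmonic (exp (-μ)) c) (n : ℕ) :
    Summable fun K ↦ abelPoint n ^ K * c K := by
  induction n with
  | zero =>
    refine summable_of_ne_finset_zero (s := {0}) fun K hK ↦ ?_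
    rw [Nat.cast_zero, abelPoint, zero_div, zero_pow (by simpa using hK), zero_mul]
  | succ n ih =>
    rw [Nat.cast_succ]
    exact (h.hasSum_abelPoint_add_one n.cast_nonneg ih.hasSum).summable

theorem hasSum_abelTransform (h : IsHarmonic (exp (-μ)) c) (hy : 0 ≤ y) :
    HasSum (fun K ↦ abelPoint y ^ K * c K) (abelTransform c y) := by
  refine Summable.hasSum (.of_nonneg_of_le
    (fun K ↦ mul_nonneg (pow_nonneg (abelPoint_nonneg hy) K) (h.nonneg K)) (fun K ↦ ?_)
    (h.summable_abelPoint_natCast ⌈y⌉₊))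
  gcongr
  exacts [h.nonneg K, abelPoint_nonneg hy, abelPoint_le_abelPoint hy (Nat.le_ceil y)]

theorem abelTransform_add_one (h : IsHarmonic (exp (-μ)) c) (hy : 0 ≤ y) :
    abelTransform c (y + 1) = ((2 + y) / (1 + y)) ^ 2 * exp μ * abelTransform c y :=
  (h.hasSum_abelPoint_add_one hy (h.hasSum_abelTransform hy)).tsum_eq

theorem abelTransform_zero (h : IsHarmonic (exp (-μ)) c) : abelTransform c 0 = 1 := by
  refine (tsum_eq_single 0 fun K hK ↦ ?_).trans (by rw [pow_zero, one_mul, h.apply_zero])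
  rw [abelPoint, zero_div, zero_pow hK, zero_mul]

theorem abelTransform_pos (h : IsHarmonic (exp (-μ)) c) (hy : 0 ≤ y) : 0 < abelTransform c y := by
  have hle := le_hasSum (h.hasSum_abelTransform hy) 0
    fun K _ ↦ mul_nonneg (pow_nonneg (abelPoint_nonneg hy) K) (h.nonneg K)
  rw [pow_zero, one_mul, h.apply_zero] at hle
  exact one_pos.trans_le hle

theorem abelTransform_le_rpow_mul_rpow (h : IsHarmonic (exp (-μ)) c) (hx : 0 < x) (hy : 0 < y)
    (hz : 0 < z) {a : ℝ} (ha₀ : 0 ≤ a) (ha₁ : a ≤ 1) (hinv : z⁻¹ = (1 - a) * x⁻¹ + a * y⁻¹) :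
    abelTransform c z ≤ abelTransform c x ^ (1 - a) * abelTransform c y ^ a := by
  have hx' := (abelPoint_pos hx).le
  have hy' := (abelPoint_pos hy).le
  have hX := h.abelTransform_pos hx.le
  have hY := h.abelTransform_pos hy.le
  have hterm (K : ℕ) : abelPoint z ^ K * c K /
      (abelTransform c x ^ (1 - a) * abelTransform c y ^ a) ≤
        (1 - a) * (abelPoint x ^ K * c K / abelTransform c x) +
          a * (abelPoint y ^ K * c K / abelTransform c y) := by
    have hc := h.nonneg K
    refine le_trans ?_ (geom_mean_le_arith_mean2_weighted (sub_nonneg.2 ha₁) ha₀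
      (by positivity) (by positivity) (sub_add_cancel 1 a))
    rw [div_rpow (by positivity) hX.le, div_rpow (by positivity) hY.le, div_mul_div_comm]
    refine div_le_div_of_nonneg_right ?_ (by positivity)
    rw [mul_rpow (by positivity) hc, mul_rpow (by positivity) hc, mul_mul_mul_comm,
      ← rpow_add_of_nonneg hc (sub_nonneg.2 ha₁) ha₀, sub_add_cancel, rpow_one,
      ← rpow_pow_comm hx', ← rpow_pow_comm hy', ← mul_pow]
    gcongr
    exacts [abelPoint_nonneg hz.le, abelPoint_le_rpow_mul_rpow hx hy hz ha₀ ha₁ hinv]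
  have hsum := hasSum_le hterm ((h.hasSum_abelTransform hz.le).div_const _)
    ((((h.hasSum_abelTransform hx.le).div_const _).mul_left _).add
      (((h.hasSum_abelTransform hy.le).div_const _).mul_left _))
  rwa [div_self hX.ne', div_self hY.ne', mul_one, mul_one, sub_add_cancel,
    div_le_one (by positivity)] at hsum

theorem abelTransform_le_mul_rpow (h : IsHarmonic (exp (-μ)) c) (hx : 0 < x) (hxz : x ≤ z)
    (hzx : z ≤ x + 1) : abelTransform c z ≤
      abelTransform c x * (((2 + x) / (1 + x)) ^ 2 * exp μ) ^ ((z - x) * (x + 1) / z) := by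
  have hz := hx.trans_le hxz
  have hx₁ : 0 < x + 1 := by linarith
  have hP := h.abelTransform_pos hx.le
  set a := (z - x) * (x + 1) / z
  calc abelTransform c z ≤ abelTransform c x ^ (1 - a) * abelTransform c (x + 1) ^ a := by
        refine h.abelTransform_le_rpow_mul_rpow hx hx₁ hz
          (div_nonneg (mul_nonneg (sub_nonneg.2 hxz) hx₁.le) hz.le) ?_ ?_
        · rw [div_le_one hz]; nlinarith
        · simp only [a]; field_simp; ring
    _ = _ := by
        rw [h.abelTransform_add_one hx.le, mul_rpow (by positivity) hP.le, mul_comm (_ ^ a),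
          ← mul_assoc, ← rpow_add hP, sub_add_cancel, rpow_one]

theorem abelTransform_add_natCast (h : IsHarmonic (exp (-μ)) c) (hy : 0 ≤ y) (n : ℕ) :
    abelTransform c (y + n) = ((1 + y + n) / (1 + y)) ^ 2 * exp μ ^ n * abelTransform c y := by
  induction n with
  | zero => rw [Nat.cast_zero, add_zero, add_zero, div_self (by positivity)]; simp
  | succ n ih =>
    rw [Nat.cast_succ, ← add_assoc, h.abelTransform_add_one (by positivity), ih]
    field_simp
    ring

theorem abelTransform_div_le (h : IsHarmonic (exp (-μ)) c) (hx : 0 < x) (hxz : x ≤ z)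
    (hzx : z ≤ x + 1) : abelTransform c z / ((1 + z) ^ 2 * exp (μ * z)) ≤
      abelTransform c x / ((1 + x) ^ 2 * exp (μ * x)) := by
  have hz := hx.trans_le hxz
  -- Log-convexity at the translates `x + n`, `z + n` gives monotonicity up to a factor
  -- that tends to `1`.
  let E (n : ℕ) : ℝ := ((1 + x + n) / (1 + z + n)) ^ 2 * exp (μ * (x - z)) *
    (((2 + x + n) / (1 + x + n)) ^ 2 * exp μ) ^ ((z - x) * ((x + 1 + n) / (z + n)))
  have hE : Tendsto E atTop (𝓝 1) := by
    have hone (a b : ℝ) : Tendsto (fun n : ℕ ↦ (a + n) / (b + n)) atTop (𝓝 1) := by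
      simpa using tendsto_add_mul_div_add_mul_atTop_nhds a b 1 one_ne_zero
    have h := (((hone (1 + x) (1 + z)).pow 2).mul_const (exp (μ * (x - z)))).mul
      ((((hone (2 + x) (1 + x)).pow 2).mul_const (exp μ)).rpow
        ((hone (x + 1) z).const_mul (z - x)) (.inl (by positivity)))
    convert h using 2
    rw [one_pow, one_mul, one_mul, mul_one, ← exp_mul, ← exp_add, ← mul_add, sub_add_sub_cancel,
      sub_self, mul_zero, exp_zero]
  refine ge_of_tendsto' (mul_one (abelTransform c x / _) ▸ hE.const_mul _) fun n ↦ ?_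
  have hconv := h.abelTransform_le_mul_rpow (x := x + n) (z := z + n) (by positivity)
    (by linarith) (by linarith)
  rw [h.abelTransform_add_natCast hx.le, h.abelTransform_add_natCast hz.le,
    add_sub_add_right_eq_sub, add_right_comm x, mul_div_assoc, ← add_assoc, ← add_assoc] at hconv
  simp only [E]
  rw [mul_sub, exp_sub, div_le_iff₀ (by positivity)]
  field_simp at hconv ⊢
  exact hconv

theorem abelTransform_eq (h : IsHarmonic (exp (-μ)) c) (hy : 0 < y) (hy₁ : y ≤ 1) :
    abelTransform c y = (1 + y) ^ 2 * exp (μ * y) := by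
  have hone : abelTransform c 1 / ((1 + 1) ^ 2 * exp (μ * 1)) = 1 := by
    have h₁ := h.abelTransform_add_one le_rfl
    rw [zero_add, h.abelTransform_zero] at h₁
    rw [h₁, mul_one, div_eq_one_iff_eq (by positivity)]
    norm_num
  have hle := h.abelTransform_div_le one_pos (z := y + 1) (by linarith) (by linarith)
  have hge := h.abelTransform_div_le hy hy₁ (by linarith)
  have hperiod : abelTransform c (y + 1) / ((1 + (y + 1)) ^ 2 * exp (μ * (y + 1))) =
      abelTransform c y / ((1 + y) ^ 2 * exp (μ * y)) := by
    rw [h.abelTransform_add_one hy.le, mul_add, mul_one, exp_add]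
    field_simp
    ring
  rw [hone] at hle hge
  rw [hperiod] at hle
  exact (div_eq_one_iff_eq (by positivity)).1 (le_antisymm hle hge)

end IsHarmonic

end HarmonicUnique

section LimitRatio

open Finset Real
open scoped Nat

variable {μ y : ℝ} {c : ℕ → ℝ}

/-- The limit of `forestRatio (exp (-μ)) n K` as `n → ∞`. -/
noncomputable def limitRatio (μ : ℝ) (K : ℕ) : ℝ :=
  2 ^ K * ∑ R ∈ range (K + 1), ((K + 1).choose (R + 1) : ℝ) * (μ ^ R / R !)

theorem limitRatio_nonneg (hμ : 0 ≤ μ) (K : ℕ) : 0 ≤ limitRatio μ K := by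
  unfold limitRatio; positivity

theorem hasSum_pow_mul_choose_succ {z : ℝ} (hz : |z| < 1) (R : ℕ) :
    HasSum (fun K ↦ z ^ K * ((K + 1).choose (R + 1) : ℝ)) (z ^ R / (1 - z) ^ (R + 2)) := by
  have h := (hasSum_choose_mul_geometric_of_norm_lt_one (R + 1) hz).mul_left (z ^ R)
  rw [mul_one_div] at h
  refine ((add_left_injective R).hasSum_iff fun K hK ↦ ?_).1 (h.congr_fun fun n ↦ ?_)
  · have hKR : K < R := by
      by_contra! hRK
      exact hK ⟨K - R, Nat.sub_add_cancel hRK⟩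
    rw [Nat.choose_eq_zero_of_lt (by omega), Nat.cast_zero, mul_zero]
  · rw [Function.comp_apply, pow_add, add_assoc]
    ring

theorem hasSum_abelPoint_pow_mul_limitRatio (hμ : 0 ≤ μ) (hy : 0 ≤ y) :
    HasSum (fun K ↦ abelPoint y ^ K * limitRatio μ K) ((1 + y) ^ 2 * exp (μ * y)) := by
  have hz₀ : 0 ≤ 2 * abelPoint y := mul_nonneg two_pos.le (abelPoint_nonneg hy)
  have hz₁ : |2 * abelPoint y| < 1 := by
    rw [abs_of_nonneg hz₀]; linarith [abelPoint_lt_half hy]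
  have hz : 2 * abelPoint y = y / (1 + y) := by unfold abelPoint; field_simp
  have hz' : 1 - 2 * abelPoint y = (1 + y)⁻¹ := by rw [hz]; field_simp; ring
  have hexp : HasSum (fun R : ℕ ↦ (2 * abelPoint y) ^ R / (1 - 2 * abelPoint y) ^ (R + 2) *
      (μ ^ R / R !)) ((1 + y) ^ 2 * exp (μ * y)) := by
    have h := (NormedSpace.expSeries_div_hasSum_exp (μ * y)).mul_left ((1 + y) ^ 2)
    rw [← Real.exp_eq_exp_ℝ] at h
    refine h.congr_fun fun R ↦ ?_
    rw [hz', hz, inv_pow, div_inv_eq_mul, div_pow, mul_pow, pow_add]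
    field_simp
  refine (hasSum_comm_of_nonneg (fun R K ↦ by positivity) (fun R ↦
    (hasSum_pow_mul_choose_succ hz₁ R).mul_right (μ ^ R / R !)) hexp fun K ↦ ?_)
  rw [limitRatio, ← mul_assoc, ← mul_pow, mul_sum, mul_comm _ 2]
  refine (hasSum_sum_of_ne_finset_zero fun R hR ↦ ?_).congr_fun fun R ↦ mul_assoc _ _ _
  rw [Nat.choose_eq_zero_of_lt (by simpa using hR), Nat.cast_zero, zero_mul, mul_zero]

theorem eq_of_eventually_tsum_pow_mul_eq {c c' : ℕ → ℝ} {C b : ℝ} (hb : 0 ≤ b)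
    (hd : ∀ K, |c K - c' K| ≤ C * b ^ K)
    (h : ∀ᶠ κ in 𝓝[>] (0 : ℝ), ∑' K, κ ^ K * (c K - c' K) = 0) : c = c' := by
  funext K
  have hK := tendsto_zero_of_tendsto_tsum_pow_mul (l := (⊤ : Filter Unit)) hb (fun _ ↦ hd)
    (h.mono fun κ hκ ↦ by simpa only [hκ] using tendsto_const_nhds) K
  exact sub_eq_zero.1 (tendsto_nhds_unique tendsto_const_nhds hK)

theorem IsHarmonic.eq_limitRatio (hμ : 0 ≤ μ) (h : IsHarmonic (exp (-μ)) c) :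
    c = limitRatio μ := by
  have hc {y : ℝ} (hy : 0 < y) (hy₁ : y ≤ 1) := h.abelTransform_eq hy hy₁ ▸
    h.hasSum_abelTransform hy.le
  have hbound {c' : ℕ → ℝ} (hc' : ∀ K, 0 ≤ c' K)
      (hsum : HasSum (fun K ↦ abelPoint 1 ^ K * c' K) ((1 + 1) ^ 2 * exp (μ * 1))) (K : ℕ) :
      c' K ≤ (1 + 1) ^ 2 * exp (μ * 1) * 4 ^ K := by
    have hfour : abelPoint 1 = 1 / 4 := by norm_num [abelPoint]
    rw [← div_le_iff₀ (by positivity)]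
    refine le_trans (le_of_eq ?_) (le_hasSum hsum K fun j _ ↦ mul_nonneg (by positivity) (hc' j))
    rw [hfour, one_div, inv_pow, inv_mul_eq_div]
  refine eq_of_eventually_tsum_pow_mul_eq (b := 4) (by norm_num) (fun K ↦
    abs_sub_le_of_nonneg_of_le (h.nonneg K) (hbound h.nonneg (hc one_pos le_rfl) K)
      (limitRatio_nonneg hμ K) (hbound (limitRatio_nonneg hμ)
        (hasSum_abelPoint_pow_mul_limitRatio hμ zero_le_one) K)) ?_
  filter_upwards [Ioo_mem_nhdsGT (by norm_num : (0 : ℝ) < 1 / 4)] with κ ⟨hκ₀, hκ₁⟩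
  have hy : 0 < 2 * κ / (1 - 2 * κ) := div_pos (by linarith) (by linarith)
  have hy₁ : 2 * κ / (1 - 2 * κ) ≤ 1 := by rw [div_le_one (by linarith)]; linarith
  have hκ : abelPoint (2 * κ / (1 - 2 * κ)) = κ := by
    have : 1 - 2 * κ ≠ 0 := by linarith
    rw [abelPoint]; field_simp; ring
  simpa only [hκ, ← mul_sub, sub_self] using
    ((hc hy hy₁).sub (hasSum_abelPoint_pow_mul_limitRatio hμ hy.le)).tsum_eq

theorem tendsto_forestRatio (hμ : 0 < μ) (K : ℕ) :
    Tendsto (fun n ↦ forestRatio (exp (-μ)) n K) atTop (𝓝 (limitRatio μ K)) := by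
  have hq : exp (-μ) < 1 := exp_lt_one_iff.2 (neg_lt_zero.2 hμ)
  refine (tendsto_iff_ultrafilter _ _ _).2 fun l hl ↦ ?_
  have hlim (K : ℕ) : ∃ a, Tendsto (fun n ↦ forestRatio (exp (-μ)) n K) l (𝓝 a) := by
    have hcompact : IsCompact (Set.Icc 0 (4 / exp (-μ) * 4 ^ K)) := isCompact_Icc
    obtain ⟨a, -, ha⟩ := hcompact.ultrafilter_le_nhds
      (l.map fun n ↦ forestRatio (exp (-μ)) n K) (tendsto_principal.2 <| .of_forall fun n ↦
        ⟨forestRatio_nonneg (exp_pos _).le n K, forestRatio_le (exp_pos _) hq n K⟩)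
    exact ⟨a, ha⟩
  choose c hc using hlim
  rw [← (isHarmonic_of_tendsto hl (exp_pos _) hq hc).eq_limitRatio hμ.le]
  exact hc K

theorem isHarmonic_limitRatio (hμ : 0 < μ) : IsHarmonic (exp (-μ)) (limitRatio μ) :=
  isHarmonic_of_tendsto le_rfl (exp_pos _) (exp_lt_one_iff.2 (neg_lt_zero.2 hμ))
    (tendsto_forestRatio hμ)

end LimitRatio

namespace PlanarTree

section Balls

variable {T T' : PlanarTree} {r : ℕ}

theorem closedBall_eq (T : PlanarTree) (hr : 1 ≤ r) :
    Metric.closedBall T (1 / (r : ℝ)) = {T' | T'.rootBall r = T.rootBall r} := by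
  ext T'
  rw [Metric.mem_closedBall, Set.mem_ofPred_eq]
  refine ⟨fun hdist ↦ ?_, dist_le_of_rootBall_eq hr⟩
  by_contra hne
  have hr2 : 1 < r := hr.lt_of_ne fun h ↦ hne (h ▸ rootBall_one_eq T' T)
  have hr2' : (1 : ℝ) < r := by exact_mod_cast hr2
  have hle : 1 / ((r : ℝ) - 1) ≤ dist T' T := by
    refine le_dist fun s hs hball ↦ ?_
    have hsr : s + 1 ≤ r := not_le.1 fun hrs ↦ hne (rootBall_eq_of_le hrs hball)
    have hsr' : (s : ℝ) + 1 ≤ r := by exact_mod_cast hsr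
    exact one_div_le_one_div_of_le (by exact_mod_cast hs) (by linarith)
  have hlt : 1 / (r : ℝ) < 1 / ((r : ℝ) - 1) :=
    one_div_lt_one_div_of_lt (by linarith) (by linarith)
  linarith

theorem HeightLE.closedBall_eq (hT : T.HeightLE r) (hr : 1 ≤ r) :
    Metric.closedBall T (1 / (r : ℝ)) = {T' | T'.rootBall r = T.verts} := by
  rw [PlanarTree.closedBall_eq T hr, hT.rootBall_eq]

theorem closedBall_trunc (T : PlanarTree) (hr : 1 ≤ r) :
    Metric.closedBall (T.trunc r hr) (1 / (r : ℝ)) = Metric.closedBall T (1 / (r : ℝ)) := by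
  rw [(T.trunc_heightLE hr).closedBall_eq hr, closedBall_eq T hr]
  rfl

theorem isClopen_closedBall (T : PlanarTree) (hr : 1 ≤ r) :
    IsClopen (Metric.closedBall T (1 / (r : ℝ))) := by
  refine ⟨Metric.isClosed_closedBall, Metric.isOpen_iff.2 fun T' hT' ↦
    ⟨1 / (r : ℝ), by positivity, Metric.ball_subset_closedBall.trans ?_⟩⟩
  rw [closedBall_eq T hr] at hT' ⊢
  rw [closedBall_eq T' hr]
  exact fun S hS ↦ Eq.trans hS hT'

theorem measurableSet_closedBall (T : PlanarTree) (r : ℕ) :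
    MeasurableSet (Metric.closedBall T (1 / (r : ℝ))) :=
  Metric.isClosed_closedBall.measurableSet

theorem HeightLE.disjoint_closedBall (hr : 1 ≤ r) (hT : T.HeightLE r) (hT' : T'.HeightLE r)
    (hne : T ≠ T') :
    Disjoint (Metric.closedBall T (1 / (r : ℝ))) (Metric.closedBall T' (1 / (r : ℝ))) := by
  rw [hT.closedBall_eq hr, hT'.closedBall_eq hr]
  exact Set.disjoint_left.2 fun S hS hS' ↦ hne (PlanarTree.ext (Eq.trans (Eq.symm hS) hS'))

theorem measureReal_biUnion_closedBall (ν : Measure PlanarTree) [IsFiniteMeasure ν]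
    (F : Finset PlanarTree) (hr : 1 ≤ r) (hF : ∀ T ∈ F, T.HeightLE r) :
    ν.real (⋃ T ∈ F, Metric.closedBall T (1 / (r : ℝ))) =
      ∑ T ∈ F, ν.real (Metric.closedBall T (1 / (r : ℝ))) :=
  measureReal_biUnion_finset
    (fun T hT T' hT' hne ↦ (hF T hT).disjoint_closedBall hr (hF T' hT') hne)
    fun T _ ↦ measurableSet_closedBall T r

end Balls

section BallVolume

variable {T : PlanarTree} {μ : ℝ} {r : ℕ}

theorem HeightLE.nu_real_closedBall (hT : T.HeightLE r) (μ : ℝ) (hr : 1 ≤ r) (N : ℕ+) :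
    (nu μ N : Measure PlanarTree).real (Metric.closedBall T (1 / (r : ℝ))) =
      (∑ T' ∈ T.treesOver r N, weight μ T') / partitionFunction μ N := by
  classical
  have hw (T' : PlanarTree) : 0 ≤ weight μ T' / partitionFunction μ N :=
    div_nonneg (Real.exp_pos _).le (partitionFunction_pos μ N.pos).le
  change (gibbsMeasure μ N).real _ = _
  rw [gibbsMeasure, measureReal_def]
  simp only [Measure.coe_finsetSum, Finset.sum_apply, Measure.smul_apply, smul_eq_mul,
    Measure.dirac_apply' _ (measurableSet_closedBall T r)]
  rw [ENNReal.toReal_sum fun T' _ ↦ ENNReal.mul_ne_top ENNReal.ofReal_ne_top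
      (by rw [Set.indicator_apply]; split_ifs <;> simp),
    treesOver, Finset.sum_filter, Finset.sum_div]
  refine Finset.sum_congr rfl fun T' _ ↦ ?_
  rw [hT.closedBall_eq hr, ENNReal.toReal_mul, ENNReal.toReal_ofReal (hw T'),
    Set.indicator_apply]
  by_cases h : T'.rootBall r = T.verts <;> simp [h]

/-- The limiting mass of the ball of radius `1/r` around a tree `T` of height `r`.  The index of
`limitRatio` is `|D_r(T)| - 1`, where `D_r(T)` is not empty. -/
noncomputable def ballVolume (μ : ℝ) (r : ℕ) (T : PlanarTree) : ℝ :=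
  4 * Real.exp (-μ * ((r : ℝ) - 1)) / 4 ^ T.size.toNat *
    limitRatio μ ((T.levelFinset r).card - 1)

theorem exists_card_levelFinset_eq_succ (hr : 1 ≤ r) (hT : T.height = r) :
    ∃ k, (T.levelFinset r).card = k + 1 :=
  Nat.exists_eq_succ_of_ne_zero ((height_eq_iff hr).1 hT).2.card_ne_zero

theorem ballVolume_eq (hr : 1 ≤ r) (hT : T.height = r) : ballVolume μ r T =
    Real.exp (-μ * ((r : ℝ) - 1)) / 4 ^ T.size.toNat * 2 ^ ((T.level r).ncard + 1) *
      ∑ R ∈ Finset.Icc 1 (T.level r).ncard,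
        ((T.level r).ncard.choose R : ℝ) * (μ ^ (R - 1) / ((R - 1).factorial : ℝ)) := by
  obtain ⟨k, hk⟩ := exists_card_levelFinset_eq_succ hr hT
  have hsum := Finset.sum_Ico_add'
    (fun R ↦ ((k + 1).choose R : ℝ) * (μ ^ (R - 1) / ((R - 1).factorial : ℝ))) 0 (k + 1) 1
  rw [← Finset.range_eq_Ico, zero_add, Finset.Ico_add_one_right_eq_Icc] at hsum
  rw [ballVolume, ncard_level, hk, ← hsum, Nat.add_sub_cancel, limitRatio]
  simp only [Nat.add_sub_cancel]
  ring

theorem hasBallVolumes_iff {ν : ProbabilityMeasure PlanarTree} : HasBallVolumes μ ν ↔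
    ∀ (r : ℕ) (T : PlanarTree), 1 ≤ r → T.height = r →
      (ν : Measure PlanarTree).real (Metric.closedBall T (1 / (r : ℝ))) = ballVolume μ r T := by
  refine forall₂_congr fun r T ↦ forall_congr' fun hr ↦
    ⟨fun h hT ↦ ?_, fun h _ hT ↦ ?_⟩
  · rw [ballVolume_eq hr hT, h (heightLE_of_height_eq hT).isFinite hT]
  · rw [← ballVolume_eq hr hT, h hT]

theorem nu_real_closedBall_eq_of_height_eq (μ : ℝ) (hr : 1 ≤ r) (hT : T.height = r) {N : ℕ+}
    (hN : T.size.toNat ≤ N) :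
    (nu μ N : Measure PlanarTree).real (Metric.closedBall T (1 / (r : ℝ))) =
      Real.exp (-μ) ^ (r - 1) *
        (forestWeight (Real.exp (-μ)) (T.levelFinset r).card (N.natPred - (T.size.toNat - 1)) /
          forestWeight (Real.exp (-μ)) 1 N.natPred) := by
  have hTle := heightLE_of_height_eq hT
  have hs := hTle.one_le_size
  have hN' := N.natPred_add_one
  obtain ⟨n, hn⟩ := Nat.exists_eq_add_of_le hN
  obtain ⟨r, rfl⟩ := Nat.exists_eq_add_of_le' hr
  rw [hTle.nu_real_closedBall μ hr, ← hN', partitionFunction_succ, hN', hn,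
    sum_treesOver_weight μ hr hT, show N.natPred - (T.size.toNat - 1) = n by omega, pow_succ',
    mul_assoc, mul_div_mul_left _ _ (Real.exp_ne_zero _), Nat.add_sub_cancel, mul_div_assoc]

theorem tendsto_nu_real_closedBall (hμ : 0 < μ) (hr : 1 ≤ r) (hT : T.height = r) :
    Tendsto (fun N : ℕ+ ↦ (nu μ N : Measure PlanarTree).real
      (Metric.closedBall T (1 / (r : ℝ)))) atTop (𝓝 (ballVolume μ r T)) := by
  obtain ⟨k, hk⟩ := exists_card_levelFinset_eq_succ hr hT
  have hs := (heightLE_of_height_eq hT).one_le_size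
  have hlim := (tendsto_forestWeight_sub_div le_rfl (Real.exp_pos _) (by simpa using hμ)
    (tendsto_forestRatio hμ k) (T.size.toNat - 1)).const_mul (Real.exp (-μ) ^ (r - 1))
  have hval : ballVolume μ r T =
      Real.exp (-μ) ^ (r - 1) * (limitRatio μ k / 4 ^ (T.size.toNat - 1)) := by
    rw [ballVolume, hk, Nat.add_sub_cancel, ← Real.exp_nat_mul, Nat.cast_sub hr, Nat.cast_one,
      mul_comm _ (-μ), ← Nat.sub_add_cancel hs, pow_succ', Nat.add_sub_cancel]
    field_simp
  have hpred : Tendsto PNat.natPred atTop atTop :=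
    tendsto_atTop_atTop.2 fun n ↦ ⟨n.succPNat, fun N hN ↦ by
      have := N.natPred_add_one
      have : n + 1 ≤ (N : ℕ) := hN
      omega⟩
  rw [hval]
  refine (hlim.comp hpred).congr' ?_
  filter_upwards [tendsto_PNat_val_atTop_atTop.eventually_ge_atTop T.size.toNat] with N hN
  rw [nu_real_closedBall_eq_of_height_eq μ hr hT hN, hk]
  rfl

end BallVolume

section Mass

variable {T : PlanarTree} {μ : ℝ} {r : ℕ}

theorem HeightLE.ballVolume_of_mem_extensions (hT : T.HeightLE r) {S : PlanarTree} {j : ℕ}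
    (hS : S ∈ T.extensions r (j + 1)) : ballVolume μ (r + 1) S =
      4 * Real.exp (-μ * r) / 4 ^ T.size.toNat * (limitRatio μ j / 4 ^ (j + 1)) := by
  rw [ballVolume, (hT.mem_extensions.1 hS).2.2, size_of_mem_extensions hS, ENat.toNat_natCast,
    pow_add, Nat.cast_add_one, add_sub_cancel_right, Nat.add_sub_cancel]
  field_simp

theorem hasSum_ballVolume_extensions (hμ : 0 < μ) (hr : 1 ≤ r) (hT : T.height = r) :
    HasSum (fun j ↦ ∑ S ∈ T.extensions r (j + 1), ballVolume μ (r + 1) S)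
      (ballVolume μ r T) := by
  obtain ⟨k, hk⟩ := exists_card_levelFinset_eq_succ hr hT
  have hTle := heightLE_of_height_eq hT
  have hsum := ((isHarmonic_limitRatio hμ).hasSum k).mul_left
    (4 * Real.exp (-μ * r) / 4 ^ T.size.toNat)
  have hexp : Real.exp (-μ * ((r : ℝ) - 1)) = Real.exp (-μ * r) * (Real.exp (-μ))⁻¹ := by
    rw [← Real.exp_neg, ← Real.exp_add]
    ring_nf
  convert! hsum using 1
  · ext j
    rw [Finset.sum_congr rfl fun S hS ↦ hTle.ballVolume_of_mem_extensions hS, Finset.sum_const,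
      hTle.card_extensions hr, hk, nsmul_eq_mul]
    ring
  · rw [ballVolume, hk, hexp, Nat.add_sub_cancel]
    ring

open Classical in
theorem sum_biUnion_extensions {F : Finset PlanarTree} (hF : ∀ T ∈ F, T.HeightLE r)
    (J : Finset ℕ) (g : PlanarTree → ℝ) :
    ∑ S ∈ (F ×ˢ J).biUnion (fun p ↦ p.1.extensions r (p.2 + 1)), g S =
      ∑ j ∈ J, ∑ T ∈ F, ∑ S ∈ T.extensions r (j + 1), g S := by
  rw [Finset.sum_biUnion, Finset.sum_product_right]
  intro p hp q hq hpq
  refine Finset.disjoint_left.2 fun S hS hS' ↦ hpq ?_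
  have hp' := hF _ (Finset.mem_product.1 (Finset.mem_coe.1 hp)).1
  have hq' := hF _ (Finset.mem_product.1 (Finset.mem_coe.1 hq)).1
  obtain ⟨hfst, hsnd⟩ := hp'.eq_of_mem_extensions hq' hS hS'
  exact Prod.ext hfst (Nat.succ_injective hsnd)

theorem ballVolume_path_one (μ : ℝ) : ballVolume μ 1 (path 1 le_rfl) = 1 := by
  rw [ballVolume, levelFinset_one, size_path_one]
  simp [limitRatio]

theorem exists_finset_lt_sum_ballVolume (hμ : 0 < μ) (hr : 1 ≤ r) {ε : ℝ} (hε : 0 < ε) :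
    ∃ F : Finset PlanarTree, (∀ T ∈ F, T.height = r) ∧ 1 - ε < ∑ T ∈ F, ballVolume μ r T := by
  classical
  induction r, hr using Nat.le_induction with
  | base =>
    refine ⟨{path 1 le_rfl}, fun T hT ↦ Finset.mem_singleton.1 hT ▸ path_one_height, ?_⟩
    rw [Finset.sum_singleton, ballVolume_path_one]
    linarith
  | succ r hr ih =>
    obtain ⟨F, hF, hlt⟩ := ih
    have hsum : HasSum (fun j ↦ ∑ T ∈ F, ∑ S ∈ T.extensions r (j + 1), ballVolume μ (r + 1) S)
        (∑ T ∈ F, ballVolume μ r T) :=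
      hasSum_sum fun T hT ↦ hasSum_ballVolume_extensions hμ hr (hF T hT)
    have hFle : ∀ T ∈ F, T.HeightLE r := fun T hT ↦ heightLE_of_height_eq (hF T hT)
    obtain ⟨J, hJ⟩ := (hsum.tendsto_sum_nat.eventually (lt_mem_nhds hlt)).exists
    refine ⟨(F ×ˢ Finset.range J).biUnion fun p ↦ p.1.extensions r (p.2 + 1), fun S hS ↦ ?_, ?_⟩
    · obtain ⟨p, hp, hS⟩ := Finset.mem_biUnion.1 hS
      exact (hFle _ (Finset.mem_product.1 hp).1).height_of_mem_extensions_succ hS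
    · rwa [sum_biUnion_extensions hFle]

end Mass

section Uniqueness

variable {T : PlanarTree} {μ : ℝ} {r : ℕ} {ν ν' : ProbabilityMeasure PlanarTree}

/-- The closed balls of radius `1/r`.  Each of them fixes the ball `B_r` of a tree; they form a
countable base of clopen sets stable under intersections, so that they determine measures. -/
def cylinders : Set (Set PlanarTree) :=
  {s | ∃ (r : ℕ) (T : PlanarTree), 1 ≤ r ∧ s = Metric.closedBall T (1 / (r : ℝ))}

theorem isTopologicalBasis_cylinders : TopologicalSpace.IsTopologicalBasis cylinders := by
  refine TopologicalSpace.isTopologicalBasis_of_isOpen_of_nhds ?_ fun T U hT hU ↦ ?_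
  · rintro _ ⟨r, T, hr, rfl⟩
    exact (isClopen_closedBall T hr).isOpen
  · obtain ⟨ε, hε, hsub⟩ := Metric.isOpen_iff.1 hU T hT
    obtain ⟨n, hn⟩ := exists_nat_one_div_lt hε
    refine ⟨_, ⟨n + 1, T, n.succ_pos, rfl⟩, Metric.mem_closedBall_self (by positivity),
      (Metric.closedBall_subset_ball ?_).trans hsub⟩
    exact_mod_cast hn

theorem countable_cylinders : cylinders.Countable := by
  have hfinite : {T : PlanarTree | T.verts.Finite}.Countable := by
    have hsets : {s : Set (List ℕ) | s.Finite}.Countable := by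
      simpa using Set.countable_ofPred_finite_subset (Set.countable_univ (α := List ℕ))
    exact hsets.preimage_of_injOn (f := verts) fun T _ T' _ h ↦ PlanarTree.ext h
  refine (Set.countable_iUnion fun r : ℕ ↦
    hfinite.image fun T ↦ Metric.closedBall T (1 / (r : ℝ))).mono ?_
  rintro _ ⟨r, T, hr, rfl⟩
  exact Set.mem_iUnion.2 ⟨r, T.trunc r hr, (T.trunc_heightLE hr).verts_finite,
    closedBall_trunc T hr⟩

theorem closedBall_subset_closedBall_of_inter_nonempty {r' : ℕ} {T' : PlanarTree} (hr : 1 ≤ r)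
    (hrr' : r ≤ r')
    (h : (Metric.closedBall T (1 / (r : ℝ)) ∩ Metric.closedBall T' (1 / (r' : ℝ))).Nonempty) :
    Metric.closedBall T' (1 / (r' : ℝ)) ⊆ Metric.closedBall T (1 / (r : ℝ)) := by
  rw [closedBall_eq T hr, closedBall_eq T' (hr.trans hrr')] at *
  obtain ⟨S, hS, hS'⟩ := h
  exact fun S' hS'' ↦ (rootBall_eq_of_le hrr' (Eq.trans hS'' (Eq.symm hS'))).trans hS

theorem isPiSystem_cylinders : IsPiSystem cylinders := by
  rintro _ ⟨r, T, hr, rfl⟩ _ ⟨r', T', hr', rfl⟩ hne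
  rcases le_total r r' with h | h
  · rw [Set.inter_eq_right.2 (closedBall_subset_closedBall_of_inter_nonempty hr h hne)]
    exact ⟨r', T', hr', rfl⟩
  · rw [Set.inter_comm] at hne ⊢
    rw [Set.inter_eq_right.2 (closedBall_subset_closedBall_of_inter_nonempty hr' h hne)]
    exact ⟨r, T, hr, rfl⟩

theorem probabilityMeasure_ext
    (h : ∀ (r : ℕ) (T : PlanarTree), 1 ≤ r → T.HeightLE r →
      (ν : Measure PlanarTree).real (Metric.closedBall T (1 / (r : ℝ))) =
        (ν' : Measure PlanarTree).real (Metric.closedBall T (1 / (r : ℝ)))) : ν = ν' := by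
  have : SecondCountableTopology PlanarTree :=
    isTopologicalBasis_cylinders.secondCountableTopology countable_cylinders
  refine ProbabilityMeasure.toMeasure_injective (ext_of_generate_finite cylinders
    isTopologicalBasis_cylinders.borel_eq_generateFrom isPiSystem_cylinders ?_ ?_)
  · rintro _ ⟨r, T, hr, rfl⟩
    rw [← closedBall_trunc T hr]
    exact (measureReal_eq_measureReal_iff (measure_ne_top _ _) (measure_ne_top _ _)).1
      (h r _ hr (T.trunc_heightLE hr))
  · simp only [measure_univ]

/-- The balls around trees of height `r` already carry the full mass. -/
theorem HasBallVolumes.real_closedBall_eq_zero (hμ : 0 < μ) (hν : HasBallVolumes μ ν)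
    (hr : 1 ≤ r) (hT : T.HeightLE r) (hne : T.height ≠ r) :
    (ν : Measure PlanarTree).real (Metric.closedBall T (1 / (r : ℝ))) = 0 := by
  refine le_antisymm (le_of_forall_pos_le_add fun ε hε ↦ ?_) measureReal_nonneg
  obtain ⟨F, hF, hlt⟩ := exists_finset_lt_sum_ballVolume hμ hr hε
  have hFle : ∀ S ∈ F, S.HeightLE r := fun S hS ↦ heightLE_of_height_eq (hF S hS)
  have hmass : (ν : Measure PlanarTree).real (⋃ S ∈ F, Metric.closedBall S (1 / (r : ℝ))) =
      ∑ S ∈ F, ballVolume μ r S := by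
    rw [measureReal_biUnion_closedBall _ F hr hFle]
    exact Finset.sum_congr rfl fun S hS ↦ hasBallVolumes_iff.1 hν r S hr (hF S hS)
  have hdisj : Disjoint (Metric.closedBall T (1 / (r : ℝ)))
      (⋃ S ∈ F, Metric.closedBall S (1 / (r : ℝ))) :=
    Set.disjoint_iUnion₂_right.2 fun S hS ↦
      hT.disjoint_closedBall hr (hFle S hS) fun h ↦ hne (h ▸ hF S hS)
  have hunion := measureReal_union (μ := (ν : Measure PlanarTree)) hdisj
    (F.measurableSet_biUnion fun S _ ↦ measurableSet_closedBall S r)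
    (measure_ne_top _ _) (measure_ne_top _ _)
  have hle := measureReal_le_one (μ := (ν : Measure PlanarTree)) (s :=
    Metric.closedBall T (1 / (r : ℝ)) ∪ ⋃ S ∈ F, Metric.closedBall S (1 / (r : ℝ)))
  linarith

theorem HasBallVolumes.unique (hμ : 0 < μ) (hν : HasBallVolumes μ ν)
    (hν' : HasBallVolumes μ ν') : ν = ν' := by
  refine probabilityMeasure_ext fun r T hr hT ↦ ?_
  by_cases h : T.height = r
  · rw [hasBallVolumes_iff.1 hν r T hr h, hasBallVolumes_iff.1 hν' r T hr h]
  · rw [hν.real_closedBall_eq_zero hμ hr hT h, hν'.real_closedBall_eq_zero hμ hr hT h]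

end Uniqueness

section Tightness

variable {μ : ℝ} {r : ℕ}

theorem mem_verts_iff_of_dist_le {u : ℕ → PlanarTree} (hu : ∀ m n, m ≤ n →
    dist (u n) (u m) ≤ 1 / ((m : ℝ) + 1)) {n : ℕ} {w : List ℕ} (hw : w.length ≤ n) :
    w ∈ (u n).verts ↔ w ∈ (u w.length).verts := by
  have hball : u n ∈ Metric.closedBall (u w.length) (1 / ((w.length + 1 : ℕ) : ℝ)) := by
    rw [Metric.mem_closedBall]
    exact_mod_cast hu w.length n hw
  rw [closedBall_eq _ w.length.succ_pos] at hball
  simpa only [mem_rootBall, Nat.le_succ, and_true] using Set.ext_iff.1 hball w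

instance : CompleteSpace PlanarTree := by
  refine Metric.complete_of_convergent_controlled_sequences (fun n ↦ 1 / ((n : ℝ) + 1))
    (fun n ↦ by positivity) fun u hu ↦ ?_
  have hmem {n : ℕ} {w : List ℕ} (hw : w.length ≤ n) :=
    mem_verts_iff_of_dist_le (fun m n hmn ↦ (hu m n m hmn le_rfl).le) hw
  let T : PlanarTree :=
    { verts := {w | w ∈ (u w.length).verts}
      root_mem := (u 0).root_mem
      singleton_mem_iff := (u 1).singleton_mem_iff
      parent_mem := fun w n h ↦ (hmem (by simp)).1 ((u _).parent_mem w n h)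
      sibling_mem := fun w m n hmn h ↦ (hmem (by simp)).1 ((u _).sibling_mem w m n hmn h)
      locally_finite := fun w ↦
        ((u (w.length + 1)).locally_finite w).subset fun n h ↦ (hmem (by simp)).2 h }
  refine ⟨T, Metric.tendsto_atTop.2 fun ε hε ↦ ?_⟩
  obtain ⟨N, hN⟩ := exists_nat_one_div_lt hε
  refine ⟨N + 1, fun n hn ↦ lt_of_le_of_lt ?_ hN⟩
  have hball : (u n).rootBall (N + 1) = T.rootBall (N + 1) := by
    ext w
    simp only [mem_rootBall]
    exact and_congr_left fun hw ↦ hmem (hw.trans hn)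
  exact_mod_cast dist_le_of_rootBall_eq N.succ_pos hball

theorem nu_compl_eq_zero (μ : ℝ) (N : ℕ+) {U : Set PlanarTree} (hU : MeasurableSet U)
    (h : ∀ T ∈ treeFinset N, T ∈ U) : (nu μ N : Measure PlanarTree) Uᶜ = 0 := by
  change gibbsMeasure μ N Uᶜ = 0
  simp only [gibbsMeasure, Measure.coe_finsetSum, Finset.sum_apply, Measure.smul_apply,
    smul_eq_mul]
  refine Finset.sum_eq_zero fun T hT ↦ ?_
  rw [Measure.dirac_apply' _ hU.compl, Set.indicator_of_notMem (Set.notMem_compl_iff.2 (h T hT)),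
    mul_zero]

theorem exists_finset_nu_compl_le (hμ : 0 < μ) (hr : 1 ≤ r) {ε : ℝ} (hε : 0 < ε) :
    ∃ F : Finset PlanarTree, ∀ N : ℕ+,
      (nu μ N : Measure PlanarTree).real (⋃ T ∈ F, Metric.closedBall T (1 / (r : ℝ)))ᶜ ≤ ε := by
  classical
  obtain ⟨F₀, hF₀, hsum⟩ := exists_finset_lt_sum_ballVolume hμ hr hε
  have hlim := tendsto_finsetSum F₀ fun T hT ↦ tendsto_nu_real_closedBall hμ hr (hF₀ T hT)
  obtain ⟨N₀, hN₀⟩ := eventually_atTop.1 (hlim.eventually (lt_mem_nhds hsum))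
  set F := F₀ ∪ (Finset.Iic N₀).biUnion fun N ↦ treeFinset N
  have hmeas : MeasurableSet (⋃ T ∈ F, Metric.closedBall T (1 / (r : ℝ))) :=
    F.measurableSet_biUnion fun T _ ↦ measurableSet_closedBall T r
  refine ⟨F, fun N ↦ ?_⟩
  rcases le_total N N₀ with hN | hN
  · rw [measureReal_def, nu_compl_eq_zero μ N hmeas fun T hT ↦ ?_, ENNReal.toReal_zero]
    · exact hε.le
    · refine Set.mem_iUnion₂.2 ⟨T, ?_, Metric.mem_closedBall_self (by positivity)⟩
      exact Finset.mem_union_right _ (Finset.mem_biUnion.2 ⟨N, Finset.mem_Iic.2 hN, hT⟩)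
  · have hlt := hN₀ N hN
    rw [← measureReal_biUnion_closedBall _ F₀ hr fun T hT ↦ heightLE_of_height_eq (hF₀ T hT)] at hlt
    have hsub : (⋃ T ∈ F₀, Metric.closedBall T (1 / (r : ℝ))) ⊆
        ⋃ T ∈ F, Metric.closedBall T (1 / (r : ℝ)) :=
      Set.biUnion_subset_biUnion_left fun T hT ↦ Finset.mem_union_left _ hT
    have hmono := measureReal_mono (μ := (nu μ N : Measure PlanarTree)) hsub (measure_ne_top _ _)
    rw [measureReal_compl hmeas, probReal_univ]
    linarith

theorem isCompact_iInter_biUnion_closedBall (F : ℕ → Finset PlanarTree) :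
    IsCompact (⋂ r : ℕ, ⋃ T ∈ F r, Metric.closedBall T (1 / ((r + 1 : ℕ) : ℝ))) := by
  refine TotallyBounded.isCompact_of_isClosed (Metric.totallyBounded_iff.2 fun ε hε ↦ ?_)
    (isClosed_iInter fun r ↦
      (F r).finite_toSet.isClosed_biUnion fun T _ ↦ Metric.isClosed_closedBall)
  obtain ⟨n, hn⟩ := exists_nat_one_div_lt hε
  refine ⟨F n, (F n).finite_toSet, (Set.iInter_subset _ n).trans
    (Set.iUnion₂_mono fun T _ ↦ Metric.closedBall_subset_ball ?_)⟩
  exact_mod_cast hn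

theorem isTightMeasureSet_range_nu (hμ : 0 < μ) :
    IsTightMeasureSet {(ν : Measure PlanarTree) | ν ∈ Set.range (nu μ)} := by
  rw [isTightMeasureSet_iff_exists_isCompact_measure_compl_le]
  intro ε hε
  obtain ⟨δ, hδ, hsum⟩ := ENNReal.exists_pos_sum_of_countable hε.ne' ℕ
  choose F hF using fun r : ℕ ↦
    exists_finset_nu_compl_le hμ (Nat.le_add_left 1 r) (NNReal.coe_pos.2 (hδ r))
  refine ⟨_, isCompact_iInter_biUnion_closedBall F, ?_⟩
  rintro _ ⟨_, ⟨N, rfl⟩, rfl⟩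
  rw [Set.compl_iInter]
  refine (measure_iUnion_le _).trans ((ENNReal.tsum_le_tsum fun r ↦ ?_).trans hsum.le)
  rw [← ofReal_measureReal (measure_ne_top _ _), ← ENNReal.ofReal_coe_nnreal]
  exact ENNReal.ofReal_le_ofReal (hF r N)

theorem hasBallVolumes_of_mapClusterPt (hμ : 0 < μ) {ν : ProbabilityMeasure PlanarTree}
    (h : MapClusterPt ν atTop (nu μ)) : HasBallVolumes μ ν := by
  obtain ⟨U, hU, hlim⟩ := mapClusterPt_iff_ultrafilter.1 h
  refine hasBallVolumes_iff.2 fun r T hr hT ↦ ?_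
  have hball := (NNReal.continuous_coe.tendsto _).comp
    (ProbabilityMeasure.tendsto_measure_of_isClopen_of_tendsto hlim (isClopen_closedBall T hr))
  exact tendsto_nhds_unique hball ((tendsto_nu_real_closedBall hμ hr hT).mono_left hU)

end Tightness

end PlanarTree

theorem mainTheorem1 (μ : ℝ) (hμ : 0 < μ) :
    ∃ ν : ProbabilityMeasure PlanarTree,
      Tendsto (PlanarTree.nu μ) atTop (𝓝 ν) ∧
      PlanarTree.HasBallVolumes μ ν ∧
      ∀ ν' : ProbabilityMeasure PlanarTree, PlanarTree.HasBallVolumes μ ν' → ν' = ν := by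
  have hcompact := isCompact_closure_of_isTightMeasureSet
    (PlanarTree.isTightMeasureSet_range_nu hμ)
  have hmem : ∀ N, PlanarTree.nu μ N ∈ closure (Set.range (PlanarTree.nu μ)) :=
    fun N ↦ subset_closure ⟨N, rfl⟩
  obtain ⟨ν, -, hν⟩ := hcompact.exists_mapClusterPt (f := atTop) (u := PlanarTree.nu μ)
    (tendsto_principal.2 (Eventually.of_forall hmem))
  have hvol := PlanarTree.hasBallVolumes_of_mapClusterPt hμ hν
  refine ⟨ν, ?_, hvol, fun ν' h ↦ h.unique hμ hvol⟩
  exact hcompact.tendsto_nhds_of_unique_mapClusterPt (Eventually.of_forall hmem) fun ν' _ h ↦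
    (PlanarTree.hasBallVolumes_of_mapClusterPt hμ h).unique hμ hvol
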